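/- **Setting.** Let $P_{Y|X}$ be a discrete memoryless channel with finite alphabets $\mathcal X,\mathcal Y$, and let $R_{\max}>0$. A codebook of length $N$ assigns a codeword in $\mathcal X^N$ to each message $W\in\{1,\dots,\lfloor 2^{NR_{\max}}\rfloor\}$; the standard rate of $W$ is $r(W)=\frac1N\log_2 W$. A generalized random coding scheme of length $N$ is a random codebook $\mathcal C_\theta$, $\theta\sim\gamma^{(N)}$, whose symbols $X_{W,j}$ are independent over all $W,j$, with $X_{W,j}\sim P^{(N)}_{X|W}$ for all $j$. Let $r\mapsto P_{X|r}$ be a family of distributions on $\mathcal X$, $r\in[0,R_{\max}]$. A sequence of schemes, one for each $N$, follows the asymptotic input distribution $P_{X|r}$ if $P^{(N)}_{X|W^{(N)}}-P_{X|r(W^{(N)})}\to0$ for each message sequence $(W^{(N)})$ whose rate $r(W^{(N)})$ converges. Write $I_r(X;Y)$ for the mutual information (in bits) and $Q_r$ for the distribution of $Y$ under input distribution $P_{X|r}$. A decoder maps the codebook in use and the channel output in $\mathcal Y^N$ to a message estimate or to "collision". $P_e(W)$ is the probability that its output is not $W$, and $P_c(W)$ the probability that it is "collision", when $W$ is sent,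 averaged over the random codebook. A region $R\subseteq[0,R_{\max}]$ with closure $R_c$ is asymptotically achievable if there is a sequence of decoders such that 1. $P_e(W^{(N)})\to0$ for all message sequences with $r(W^{(N)})\in R$ for all large $N$ and $\lim_N r(W^{(N)})\in R$; 2. $P_c(W^{(N)})\to1$ for all message sequences with $r(W^{(N)})\notin R_c$ for all large $N$ and $\lim_N r(W^{(N)})$ existing and not in $R_c$. **Theorem 1.** Let a sequence of generalized random coding schemes follow $P_{X|r}$, where $P_{X|r}$ is continuous in $r\in[0,R_{\max}]$ except at finitely many points. Put $R=\{r\in[0,R_{\max}] : r=0 \text{ or } r<I_r(X;Y)\}$. *Achievability.* Assume that the rate-zero message is distinguishable from transmissions outside the region: either $I_0(X;Y)>0$, or for every $s\in[0,R_{\max}]\setminus R_c$ the distribution $Q_r$ stays bounded away from $Q_0$ for $r\in[0,R_{\max}]$ near $s$. Then: (a) There is a single sequence of decoders that satisfies condition 2 for $R$ and such that for all $\varepsilon_1,\varepsilon_2>0$ there is $N_0$ such that, for all $N\ge N_0$, every message $W$ with $r(W)=0$ or $r(W)<I_{r(W)}(X;Y)-\varepsilon_2$ has $P_e(W)<\varepsilon_1$.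 (b) If moreover every $s\in R$ has a neighbourhood in $R$ on whose nonzero rates $r$ the gap $I_r(X;Y)-r$ is bounded away from $0$ (which is automatic at each $s\in R$, $s\ne 0$, at which $P_{X|r}$ is continuous), then $R$ is asymptotically achievable. *Converse.* Let $\tilde R\subseteq[0,R_{\max}]$ be any asymptotically achievable region, and let $\tilde r$ be such that $[\tilde r,\tilde r+\delta]\subseteq\tilde R$ for some $\delta>0$. If $P_{X|r}$ is continuous in $r$ at $\tilde r$, then $\tilde r\le I_{\tilde r}(X;Y)$. -/

import Mathlib

open Filter Topology MeasureTheory ProbabilityTheory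

noncomputable section

/-- The output distribution `Q(y) = ∑ₓ p(x) P_{Y|X}(y|x)` of the channel `ch` under input
distribution `p`.  A probability distribution on a finite alphabet is a point of `stdSimplex ℝ _`. -/
def outputDist {X Y : Type*} [Fintype X] [Fintype Y]
    (ch : X → stdSimplex ℝ Y) (p : stdSimplex ℝ X) (y : Y) : ℝ :=
  ∑ x, p x * ch x y

/-- Mutual information `I(X;Y)` in bits, for input distribution `p` and channel `ch`.  A summand
with `p x * ch x y = 0` vanishes; in every other one the output probability is positive. -/
def mutualInfo {X Y : Type*} [Fintype X] [Fintype Y]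
    (ch : X → stdSimplex ℝ Y) (p : stdSimplex ℝ X) : ℝ :=
  ∑ x, ∑ y, p x * ch x y * Real.logb 2 (ch x y / outputDist ch p y)

/-- The messages `1, 2, …, ⌊2 ^ (N * Rmax)⌋` of a code of length `N`. -/
abbrev Message (Rmax : ℝ) (N : ℕ) : Type :=
  ↥(Finset.Icc 1 ⌊(2 : ℝ) ^ ((N : ℝ) * Rmax)⌋₊)

/-- The standard communication rate `(1/N) log₂ W`. -/
def stdRate {Rmax : ℝ} {N : ℕ} (W : Message Rmax N) : ℝ :=
  Real.logb 2 ((W : ℕ) : ℝ) / N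

/-- A codebook: one codeword of length `N` for each message. -/
abbrev Codebook (X : Type*) (Rmax : ℝ) (N : ℕ) : Type _ := Message Rmax N → Fin N → X

/-- A generalized random coding scheme of codeword length `N`: a library of codebooks indexed by
`Θ`, a distribution `γ` of the index, such that the symbols `X_{W,j}` are independent over all
`W, j` and, for given `W`, all of them are distributed according to `inputDist W`. -/
structure RandomCodingScheme (X : Type*) [Fintype X] (Rmax : ℝ) (N : ℕ)
    (Θ : Type*) [MeasurableSpace Θ] where
  γ : Measure Θ
  isProb : IsProbabilityMeasure γ
  codebook : Θ → Codebook X Rmax N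
  inputDist : Message Rmax N → stdSimplex ℝ X
  measurable_symbol : ∀ (W : Message Rmax N) (j : Fin N) (x : X),
    MeasurableSet {θ | codebook θ W j = x}
  indep : iIndepFun (m := fun _ => (⊤ : MeasurableSpace X))
    (fun (p : Message Rmax N × Fin N) (θ : Θ) => codebook θ p.1 p.2) γ
  law : ∀ (W : Message Rmax N) (j : Fin N) (x : X),
    γ.real {θ | codebook θ W j = x} = inputDist W x

/-- The sequence of schemes `S` follows the asymptotic input distribution `P` (that is `P_{X|r}`):
along every message sequence whose rate converges, the input distributions of the schemes have the
same limiting behaviour as `P_{X|r(W)}`.  Neither side needs to converge, since `P` may be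
discontinuous, so this is expressed by the difference tending to zero. -/
def FollowsAsymptotically {X : Type*} [Fintype X] {Rmax : ℝ}
    {Θ : ℕ → Type*} [∀ N, MeasurableSpace (Θ N)]
    (S : ∀ N, RandomCodingScheme X Rmax N (Θ N)) (P : ℝ → stdSimplex ℝ X) : Prop :=
  ∀ W : ∀ N, Message Rmax N, (∃ r, Tendsto (fun N => stdRate (W N)) atTop (𝓝 r)) →
    ∀ x, Tendsto (fun N => (S N).inputDist (W N) x - P (stdRate (W N)) x) atTop (𝓝 0)

/-- A sequence of decoding algorithms.  From the codebook in use and the channel output the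
receiver computes a message estimate, `some W`, or reports a collision, `none`. -/
abbrev DecoderSeq (X Y : Type*) (Rmax : ℝ) : Type _ :=
  ∀ N : ℕ, Codebook X Rmax N → (Fin N → Y) → Option (Message Rmax N)

/-- Transition probability of a block over the memoryless channel. -/
def blockProb {X Y : Type*} [Fintype Y] (ch : X → stdSimplex ℝ Y) {N : ℕ}
    (x : Fin N → X) (y : Fin N → Y) : ℝ :=
  ∏ j, ch (x j) (y j)

/-- `P_e(W)`: probability that the output of the decoder is not `W` when `W` is sent, averaged over
the random codebook.  Reporting a collision counts as not recovering `W`. -/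
def errorProb {X Y : Type*} [Fintype X] [Fintype Y] {Rmax : ℝ}
    {Θ : ℕ → Type*} [∀ N, MeasurableSpace (Θ N)] (ch : X → stdSimplex ℝ Y)
    (S : ∀ N, RandomCodingScheme X Rmax N (Θ N)) (D : DecoderSeq X Y Rmax)
    (N : ℕ) (W : Message Rmax N) : ℝ :=
  ∫ θ, (∑ y : Fin N → Y, if D N ((S N).codebook θ) y = some W then 0
    else blockProb ch ((S N).codebook θ W) y) ∂(S N).γ

/-- `P_c(W)`: probability that the decoder reports a collision when `W` is sent, averaged over the
random codebook. -/
def collisionProb {X Y : Type*} [Fintype X] [Fintype Y] {Rmax : ℝ}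
    {Θ : ℕ → Type*} [∀ N, MeasurableSpace (Θ N)] (ch : X → stdSimplex ℝ Y)
    (S : ∀ N, RandomCodingScheme X Rmax N (Θ N)) (D : DecoderSeq X Y Rmax)
    (N : ℕ) (W : Message Rmax N) : ℝ :=
  ∫ θ, (∑ y : Fin N → Y, if D N ((S N).codebook θ) y = none
    then blockProb ch ((S N).codebook θ W) y else 0) ∂(S N).γ

/-- Reliable decoding inside the region `R`: `P_e(W⁽ᴺ⁾) → 0` whenever the rates of the messages lie
in `R` (for all large `N`) and converge to a point of `R`. -/
def ReliableInside {X Y : Type*} [Fintype X] [Fintype Y] {Rmax : ℝ}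
    {Θ : ℕ → Type*} [∀ N, MeasurableSpace (Θ N)] (ch : X → stdSimplex ℝ Y)
    (S : ∀ N, RandomCodingScheme X Rmax N (Θ N)) (D : DecoderSeq X Y Rmax) (R : Set ℝ) : Prop :=
  ∀ W : ∀ N, Message Rmax N, (∀ᶠ N in atTop, stdRate (W N) ∈ R) →
    (∃ r ∈ R, Tendsto (fun N => stdRate (W N)) atTop (𝓝 r)) →
    Tendsto (fun N => errorProb ch S D N (W N)) atTop (𝓝 0)

/-- Collision detection outside the region `R`: `P_c(W⁽ᴺ⁾) → 1` whenever the rates of the messages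
lie outside the closure of `R` (for all large `N`) and converge to a point outside it. -/
def CollisionOutside {X Y : Type*} [Fintype X] [Fintype Y] {Rmax : ℝ}
    {Θ : ℕ → Type*} [∀ N, MeasurableSpace (Θ N)] (ch : X → stdSimplex ℝ Y)
    (S : ∀ N, RandomCodingScheme X Rmax N (Θ N)) (D : DecoderSeq X Y Rmax) (R : Set ℝ) : Prop :=
  ∀ W : ∀ N, Message Rmax N, (∀ᶠ N in atTop, stdRate (W N) ∉ closure R) →
    (∃ r, r ∉ closure R ∧ Tendsto (fun N => stdRate (W N)) atTop (𝓝 r)) →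
    Tendsto (fun N => collisionProb ch S D N (W N)) atTop (𝓝 1)

/-- The rate region `R` is asymptotically achievable. -/
def AsymptoticallyAchievable {X Y : Type*} [Fintype X] [Fintype Y] {Rmax : ℝ}
    {Θ : ℕ → Type*} [∀ N, MeasurableSpace (Θ N)] (ch : X → stdSimplex ℝ Y)
    (S : ∀ N, RandomCodingScheme X Rmax N (Θ N)) (R : Set ℝ) : Prop :=
  ∃ D : DecoderSeq X Y Rmax, ReliableInside ch S D R ∧ CollisionOutside ch S D R

/-- The region of the rates `r ∈ [0, Rmax]` with `r = 0` or `r < I_r(X;Y)`. -/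
def standardRegion {X Y : Type*} [Fintype X] [Fintype Y] (Rmax : ℝ)
    (ch : X → stdSimplex ℝ Y) (P : ℝ → stdSimplex ℝ X) : Set ℝ :=
  {r | r ∈ Set.Icc 0 Rmax ∧ (r = 0 ∨ r < mutualInfo ch (P r))}

/-- Reliable decoding inside `{r | r = 0 ∨ r < I_r(X;Y)}` with an arbitrarily small back-off `ε₂`:
for all `ε₁, ε₂ > 0` there is a threshold beyond which all messages with `r(W) = 0` or
`r(W) < I_{r(W)}(X;Y) - ε₂` satisfy `P_e(W) < ε₁`.  The decoders do not depend on `ε₁, ε₂`. -/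
def ReliableWithBackoff {X Y : Type*} [Fintype X] [Fintype Y] {Rmax : ℝ}
    {Θ : ℕ → Type*} [∀ N, MeasurableSpace (Θ N)] (ch : X → stdSimplex ℝ Y)
    (S : ∀ N, RandomCodingScheme X Rmax N (Θ N)) (D : DecoderSeq X Y Rmax)
    (P : ℝ → stdSimplex ℝ X) : Prop :=
  ∀ ε₁ > 0, ∀ ε₂ > 0, ∃ N₀ : ℕ, ∀ N ≥ N₀, ∀ W : Message Rmax N,
    (stdRate W = 0 ∨ stdRate W < mutualInfo ch (P (stdRate W)) - ε₂) →
    errorProb ch S D N W < ε₁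

/-- Sending the rate-zero message can be told apart from sending at rates outside the closure of the
region: either the rate-zero codeword conveys information, or its output distribution is not a
limit of the output distributions at rates `r → s`, for any `s` outside the closure. -/
def ZeroRateDetectable {X Y : Type*} [Fintype X] [Fintype Y] (Rmax : ℝ)
    (ch : X → stdSimplex ℝ Y) (P : ℝ → stdSimplex ℝ X) : Prop :=
  0 < mutualInfo ch (P 0) ∨
    ∀ s ∈ Set.Icc 0 Rmax, s ∉ closure (standardRegion Rmax ch P) →
      ∃ ε > 0, ∀ᶠ r in 𝓝[Set.Icc 0 Rmax] s,
        ∃ y, ε ≤ |outputDist ch (P r) y - outputDist ch (P 0) y|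

/-- Near every point of the region the gap `I_r(X;Y) - r` at nonzero rates `r` of the region is
bounded away from zero (at a nonzero point of the region at which `P` is continuous this holds
automatically). -/
def LocallyPositiveMargin {X Y : Type*} [Fintype X] [Fintype Y] (Rmax : ℝ)
    (ch : X → stdSimplex ℝ Y) (P : ℝ → stdSimplex ℝ X) : Prop :=
  ∀ s ∈ standardRegion Rmax ch P, ∃ ε > 0, ∀ᶠ r in 𝓝[standardRegion Rmax ch P] s,
    r = 0 ∨ r + ε ≤ mutualInfo ch (P r)

end

/-! Integrating over the codebook reduces every probability to a finite sum over independent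
codewords with i.i.d. symbols, so Markov's and Chebyshev's inequalities suffice. Compactness of the
rate interval makes the input distributions of the schemes close to `P` uniformly over all messages
(`FollowsAsymptotically.eventually_dist_lt`).

Achievability. A message V passes its test when its likelihood exceeds V (N+1)^2 times the
probability of the output under the input distribution of V. Given the output, Markov's inequality
shows that an unsent codeword passes with probability at most 1/(V (N+1)^2), whichever message was
sent. The threshold grows with V, so the union bound is a harmonic sum, of order 1/N in total
(`sentProb_exists_likelihoodTest_le`). The logarithm of the threshold is N r(W) + O(log N), so by
Chebyshev's inequality a sent codeword passes whenever r(W) < I - ε (`sentProb_likelihood_fail_le`);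
the variance bound is uniform in the input distribution, hence so is the threshold on N. Message 1
is treated apart, since I_0 may vanish. It is the output when no other message of the region passes
and a further test accepts: its own likelihood test if I_0 > 0, or a test of the empirical output
frequencies if these separate it from rates outside the region.

Converse. If I_r < r, take at least 2^(Nr) messages with rates in [r, r + 2/N]. The decoding sets
are disjoint, so with a reference law q near Q_r and a likelihood threshold 2^(N(r - g/4)), g = r -
I_r, the average probability of correct decoding tends to 0 (`sum_sentProb_decode_le`). Hence some
message of each large block has error at least 1/2, and these messages form a sequence contradicting
reliability at r. -/

/-! ### Moments under product weights on finite alphabets -/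

section FiniteProduct

variable {Z : Type*} [Fintype Z]

lemma sum_prod_weight {N : ℕ} {q : Z → ℝ} (hq : ∑ z, q z = 1) :
    ∑ z : Fin N → Z, ∏ j, q (z j) = 1 := by
  rw [← Fintype.prod_sum (fun (_ : Fin N) z => q z)]
  simp [hq]

/-- Expectation of a product of functions of two distinct coordinates. -/
lemma sum_prod_weight_mul_mul {ι : Type*} [Fintype ι] [DecidableEq ι] {A : Type*} [Fintype A]
    {w : ι → A → ℝ} (hw : ∀ i, ∑ a, w i a = 1) {k l : ι} (hkl : k ≠ l) (g h : A → ℝ) :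
    ∑ c : ι → A, (∏ i, w i (c i)) * (g (c k) * h (c l)) =
      (∑ a, w k a * g a) * ∑ a, w l a * h a := by
  have key : ∀ c : ι → A, (∏ i, w i (c i)) * (g (c k) * h (c l)) =
      ∏ i, (w i (c i) * ((if i = k then g (c i) else 1) * (if i = l then h (c i) else 1))) := by
    intro c
    rw [Finset.prod_mul_distrib, Finset.prod_mul_distrib, Finset.prod_ite_eq' Finset.univ k,
      Finset.prod_ite_eq' Finset.univ l]
    simp
  rw [Finset.sum_congr rfl fun c _ => key c]
  rw [← Fintype.prod_sum
    (fun i a => w i a * ((if i = k then g a else 1) * (if i = l then h a else 1)))]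
  rw [Fintype.prod_eq_mul k l hkl]
  · simp [hkl, hkl.symm]
  · rintro i ⟨h1, h2⟩
    simp [h1, h2, hw]

/-- Expectation of a function of one coordinate. -/
lemma sum_prod_weight_mul {ι : Type*} [Fintype ι] [DecidableEq ι] {A : Type*} [Fintype A]
    {w : ι → A → ℝ} (hw : ∀ i, ∑ a, w i a = 1) (k : ι) (g : A → ℝ) :
    ∑ c : ι → A, (∏ i, w i (c i)) * g (c k) = ∑ a, w k a * g a := by
  have key : ∀ c : ι → A, (∏ i, w i (c i)) * g (c k) =
      ∏ i, (w i (c i) * (if i = k then g (c i) else 1)) := by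
    intro c
    rw [Finset.prod_mul_distrib, Finset.prod_ite_eq' Finset.univ k]
    simp
  rw [Finset.sum_congr rfl fun c _ => key c,
    ← Fintype.prod_sum (fun i a => w i a * (if i = k then g a else 1)), Fintype.prod_eq_single k]
  · simp
  · intro i hi
    simp [hi, hw]

/-- Expanding the square, the off-diagonal terms factor by independence and vanish because `g` is
centred. -/
lemma sum_prod_weight_mul_sum_sq {N : ℕ} {q : Z → ℝ} (hq : ∑ z, q z = 1)
    {g : Z → ℝ} (hg : ∑ z, q z * g z = 0) :
    ∑ z : Fin N → Z, (∏ j, q (z j)) * (∑ j, g (z j)) ^ 2 = N * ∑ z, q z * g z ^ 2 := by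
  classical
  have h1 : ∀ z : Fin N → Z, (∏ j, q (z j)) * (∑ j, g (z j)) ^ 2 =
      ∑ k, ∑ l, (∏ j, q (z j)) * (g (z k) * g (z l)) := by
    intro z
    rw [sq, Finset.sum_mul_sum, Finset.mul_sum]
    simp_rw [Finset.mul_sum]
  rw [Finset.sum_congr rfl fun z _ => h1 z, Finset.sum_comm]
  have h2 : ∀ k : Fin N, ∑ z : Fin N → Z, ∑ l, (∏ j, q (z j)) * (g (z k) * g (z l)) =
      ∑ z, q z * g z ^ 2 := by
    intro k
    rw [Finset.sum_comm, Finset.sum_eq_single k]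
    · have := sum_prod_weight_mul (w := fun _ : Fin N => q) (fun _ => hq) k (fun z => g z ^ 2)
      simpa [sq] using this
    · intro l _ hl
      rw [sum_prod_weight_mul_mul (w := fun _ : Fin N => q) (fun _ => hq) hl.symm g g, hg]
      simp
    · simp
  simp [h2]

/-- Chebyshev's inequality for sums of independent, identically distributed variables. -/
lemma chebyshev_iid {N : ℕ} {q : Z → ℝ} (hq0 : ∀ z, 0 ≤ q z) (hq : ∑ z, q z = 1)
    (f : Z → ℝ) {a : ℝ} (ha : 0 < a) (E : (Fin N → Z) → Prop) [DecidablePred E]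
    (hE : ∀ z, E z → ∏ j, q (z j) ≠ 0 → a ^ 2 ≤ (∑ j, f (z j) - N * ∑ x, q x * f x) ^ 2) :
    ∑ z : Fin N → Z, (∏ j, q (z j)) * (if E z then 1 else 0) ≤
      N * (∑ x, q x * f x ^ 2) / a ^ 2 := by
  set m := ∑ x, q x * f x with hm
  have hg : ∑ z, q z * (f z - m) = 0 := by
    simp_rw [mul_sub, Finset.sum_sub_distrib, ← Finset.sum_mul, hq]
    simp [hm]
  have hvar : ∑ z, q z * (f z - m) ^ 2 ≤ ∑ x, q x * f x ^ 2 := by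
    have : ∑ z, q z * (f z - m) ^ 2 = ∑ x, q x * f x ^ 2 - m ^ 2 := by
      have h : ∀ z, q z * (f z - m) ^ 2 = q z * f z ^ 2 - 2 * m * (q z * f z) + q z * m ^ 2 := by
        intro z; ring
      simp_rw [h, Finset.sum_add_distrib, Finset.sum_sub_distrib, ← Finset.mul_sum,
        ← Finset.sum_mul, hq, ← hm]
      ring
    rw [this]; nlinarith [sq_nonneg m]
  rw [le_div_iff₀ (by positivity), Finset.sum_mul]
  calc ∑ z : Fin N → Z, (∏ j, q (z j)) * (if E z then 1 else 0) * a ^ 2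
      ≤ ∑ z : Fin N → Z, (∏ j, q (z j)) * (∑ j, (f (z j) - m)) ^ 2 := by
        refine Finset.sum_le_sum fun z _ => ?_
        have h0 : 0 ≤ ∏ j, q (z j) := Finset.prod_nonneg fun j _ => hq0 _
        by_cases hz : ∏ j, q (z j) = 0
        · simp [hz]
        split_ifs with h
        · have := hE z h hz
          rw [Finset.sum_sub_distrib]
          simp only [Finset.sum_const, Finset.card_univ, Fintype.card_fin, nsmul_eq_mul]
          rw [mul_one]
          exact mul_le_mul_of_nonneg_left this h0
        · simp only [mul_zero, zero_mul]; positivity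
    _ = N * ∑ z, q z * (f z - m) ^ 2 := sum_prod_weight_mul_sum_sq hq hg
    _ ≤ _ := by gcongr

end FiniteProduct

/-! ### Averages over a random codebook and the channel output -/

section Sending

lemma blockProb_nonneg {X Y : Type*} [Fintype Y] (ch : X → stdSimplex ℝ Y) {N : ℕ}
    (x : Fin N → X) (y : Fin N → Y) : 0 ≤ blockProb ch x y :=
  Finset.prod_nonneg fun _ _ => stdSimplex.zero_le _ _

variable {X Y : Type*} [Fintype X] [Fintype Y] {ι : Type*} [Fintype ι]

open Classical in
/-- Expectation of `F` (codebook, channel output) when message `W` is sent, for codebooks with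
independent symbols of distribution `p V` in the codeword of message `V`. -/
noncomputable def sentAvg (ch : X → stdSimplex ℝ Y) (p : ι → stdSimplex ℝ X) {N : ℕ} (W : ι)
    (F : (ι → Fin N → X) → (Fin N → Y) → ℝ) : ℝ :=
  ∑ c : ι → Fin N → X, (∏ V, ∏ j, p V (c V j)) * ∑ y, blockProb ch (c W) y * F c y

/-- Joint distribution of channel input and output. -/
noncomputable def jointDist (ch : X → stdSimplex ℝ Y) (p : stdSimplex ℝ X) (z : X × Y) : ℝ :=
  p z.1 * ch z.1 z.2

lemma jointDist_nonneg (ch : X → stdSimplex ℝ Y) (p : stdSimplex ℝ X) (z : X × Y) :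
    0 ≤ jointDist ch p z :=
  mul_nonneg (stdSimplex.zero_le _ _) (stdSimplex.zero_le _ _)

lemma sum_jointDist (ch : X → stdSimplex ℝ Y) (p : stdSimplex ℝ X) :
    ∑ z, jointDist ch p z = 1 := by
  simp [jointDist, Fintype.sum_prod_type, ← Finset.mul_sum]

lemma outputDist_nonneg (ch : X → stdSimplex ℝ Y) (p : stdSimplex ℝ X) (y : Y) :
    0 ≤ outputDist ch p y :=
  Finset.sum_nonneg fun _ _ => mul_nonneg (stdSimplex.zero_le _ _) (stdSimplex.zero_le _ _)

lemma sum_outputDist (ch : X → stdSimplex ℝ Y) (p : stdSimplex ℝ X) :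
    ∑ y, outputDist ch p y = 1 := by
  unfold outputDist
  rw [Finset.sum_comm]
  simp [← Finset.mul_sum]

/-- An i.i.d. codeword through a memoryless channel gives i.i.d. outputs. This is the normalisation
behind the Markov bound in `sum_weight_likelihood_le`. -/
lemma sum_weight_blockProb (ch : X → stdSimplex ℝ Y) (p : stdSimplex ℝ X) {N : ℕ}
    (y : Fin N → Y) :
    ∑ x : Fin N → X, (∏ j, p (x j)) * blockProb ch x y = ∏ j, outputDist ch p (y j) := by
  unfold blockProb outputDist
  simp_rw [← Finset.prod_mul_distrib]
  rw [← Fintype.prod_sum (fun j x => p x * ch x (y j))]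

section

variable (ch : X → stdSimplex ℝ Y) (p : ι → stdSimplex ℝ X) {N : ℕ} (W : ι)

lemma sentAvg_mono {F G : (ι → Fin N → X) → (Fin N → Y) → ℝ} (h : ∀ c y, F c y ≤ G c y) :
    sentAvg ch p W F ≤ sentAvg ch p W G := by
  refine Finset.sum_le_sum fun c _ => mul_le_mul_of_nonneg_left
    (Finset.sum_le_sum fun y _ => mul_le_mul_of_nonneg_left (h c y) (blockProb_nonneg _ _ _)) ?_
  exact Finset.prod_nonneg fun _ _ => Finset.prod_nonneg fun _ _ => stdSimplex.zero_le _ _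

lemma sentAvg_add (F G : (ι → Fin N → X) → (Fin N → Y) → ℝ) :
    sentAvg ch p W (fun c y => F c y + G c y) = sentAvg ch p W F + sentAvg ch p W G := by
  simp [sentAvg, mul_add, Finset.sum_add_distrib]

lemma sentAvg_sum {κ : Type*} (s : Finset κ) (F : κ → (ι → Fin N → X) → (Fin N → Y) → ℝ) :
    sentAvg ch p W (fun c y => ∑ k ∈ s, F k c y) = ∑ k ∈ s, sentAvg ch p W (F k) := by
  simp only [sentAvg, Finset.mul_sum]
  simp_rw [Finset.sum_comm (t := s)]

/-- A function of the codeword sent and of the output is averaged over i.i.d. pairs. -/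
lemma sentAvg_own (G : (Fin N → X) → (Fin N → Y) → ℝ) :
    sentAvg ch p W (fun c y => G (c W) y) =
      ∑ z : Fin N → X × Y, (∏ j, jointDist ch (p W) (z j)) *
        G (fun j => (z j).1) (fun j => (z j).2) := by
  classical
  unfold sentAvg
  rw [sum_prod_weight_mul (w := fun V x => ∏ j, p V (x j))
    (fun V => sum_prod_weight (stdSimplex.sum_eq_one _)) W
    (fun x => ∑ y, blockProb ch x y * G x y)]
  simp_rw [Finset.mul_sum]
  rw [← Fintype.sum_prod_type', ← (Equiv.arrowProdEquivProdArrow _ _ _).sum_comp]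
  refine Finset.sum_congr rfl fun z _ => ?_
  simp [Equiv.arrowProdEquivProdArrow, jointDist, blockProb, Finset.prod_mul_distrib, mul_assoc]

lemma sentAvg_one : sentAvg ch p W (N := N) (fun _ _ => 1) = 1 := by
  rw [sentAvg_own ch p W (fun _ _ => 1)]
  simpa using sum_prod_weight (sum_jointDist ch (p W))

/-- A function of another codeword and of the output is averaged over independent pairs. -/
lemma sentAvg_cross {V : ι} (hVW : V ≠ W) (G : (Fin N → X) → (Fin N → Y) → ℝ) :
    sentAvg ch p W (fun c y => G (c V) y) =
      ∑ y : Fin N → Y, (∏ j, outputDist ch (p W) (y j)) *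
        ∑ x : Fin N → X, (∏ j, p V (x j)) * G x y := by
  classical
  unfold sentAvg
  simp_rw [Finset.mul_sum]
  rw [Finset.sum_comm]
  refine Finset.sum_congr rfl fun y _ => ?_
  rw [sum_prod_weight_mul_mul (w := fun V x => ∏ j, p V (x j))
    (fun V => sum_prod_weight (stdSimplex.sum_eq_one _)) hVW.symm
    (fun x => blockProb ch x y) (fun x => G x y), sum_weight_blockProb, Finset.mul_sum]

lemma sentAvg_cross_le {V : ι} (hVW : V ≠ W) (G : (Fin N → X) → (Fin N → Y) → ℝ) {b : ℝ}
    (h : ∀ y, ∑ x : Fin N → X, (∏ j, p V (x j)) * G x y ≤ b) :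
    sentAvg ch p W (fun c y => G (c V) y) ≤ b := by
  rw [sentAvg_cross ch p W hVW]
  calc _ ≤ ∑ y : Fin N → Y, (∏ j, outputDist ch (p W) (y j)) * b :=
        Finset.sum_le_sum fun y _ => mul_le_mul_of_nonneg_left (h y)
          (Finset.prod_nonneg fun _ _ => outputDist_nonneg _ _ _)
    _ = b := by rw [← Finset.sum_mul, sum_prod_weight (sum_outputDist _ _), one_mul]

end

/-- The probability that an independent codeword beats the threshold `t`. -/
lemma sum_weight_likelihood_le (ch : X → stdSimplex ℝ Y) (p : stdSimplex ℝ X) {N : ℕ}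
    {t : ℝ} (ht : 0 < t) (y : Fin N → Y) (E : (Fin N → X) → Prop) [DecidablePred E]
    (hE : ∀ x, E x → t * ∏ j, outputDist ch p (y j) < blockProb ch x y) :
    ∑ x : Fin N → X, (∏ j, p (x j)) * (if E x then 1 else 0) ≤ 1 / t := by
  have hw : ∀ x : Fin N → X, 0 ≤ ∏ j, p (x j) := fun x =>
    Finset.prod_nonneg fun _ _ => stdSimplex.zero_le _ _
  have hQ0 : 0 ≤ ∏ j, outputDist ch p (y j) :=
    Finset.prod_nonneg fun _ _ => outputDist_nonneg _ _ _
  have hsum := sum_weight_blockProb ch p y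
  rcases hQ0.eq_or_lt with hQ | hQ
  -- If the output has probability zero, every codeword of positive weight has likelihood zero,
  -- whereas `E` forces a positive likelihood.
  · rw [← hQ, Finset.sum_eq_zero_iff_of_nonneg
      (fun x _ => mul_nonneg (hw x) (blockProb_nonneg _ _ _))] at hsum
    rw [Finset.sum_eq_zero]
    · positivity
    intro x hx
    split_ifs with h
    · have h1 := hE x h
      rw [← hQ, mul_zero] at h1
      rcases mul_eq_zero.1 (hsum x hx) with h2 | h2
      · simp [h2]
      · exact absurd h2 h1.ne'
    · simp
  · calc ∑ x : Fin N → X, (∏ j, p (x j)) * (if E x then 1 else 0)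
        ≤ ∑ x : Fin N → X, (∏ j, p (x j)) * blockProb ch x y *
            (1 / (t * ∏ j, outputDist ch p (y j))) := by
          refine Finset.sum_le_sum fun x _ => ?_
          rw [mul_assoc]
          refine mul_le_mul_of_nonneg_left ?_ (hw x)
          split_ifs with h
          · rw [mul_one_div, le_div_iff₀ (by positivity), one_mul]
            exact (hE x h).le
          · have := blockProb_nonneg ch x y
            positivity
      _ = 1 / t := by
          rw [← Finset.sum_mul, hsum]
          field_simp

open Classical in
/-- Probability of the event `E` (codebook, channel output) when message `W` is sent. -/
noncomputable def sentProb (ch : X → stdSimplex ℝ Y) (p : ι → stdSimplex ℝ X) {N : ℕ} (W : ι)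
    (E : (ι → Fin N → X) → (Fin N → Y) → Prop) : ℝ :=
  sentAvg ch p W (fun c y => if E c y then 1 else 0)

section

variable (ch : X → stdSimplex ℝ Y) (p : ι → stdSimplex ℝ X) {N : ℕ} (W : ι)

lemma sentProb_nonneg (E : (ι → Fin N → X) → (Fin N → Y) → Prop) : 0 ≤ sentProb ch p W E := by
  classical
  have : sentAvg ch p W (fun _ _ => 0) ≤ sentProb ch p W E :=
    sentAvg_mono ch p W fun c y => by positivity
  simpa [sentAvg] using this

lemma sentProb_le_add {A B C : (ι → Fin N → X) → (Fin N → Y) → Prop}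
    (h : ∀ c y, A c y → B c y ∨ C c y) :
    sentProb ch p W A ≤ sentProb ch p W B + sentProb ch p W C := by
  classical
  unfold sentProb
  rw [← sentAvg_add]
  refine sentAvg_mono ch p W fun c y => ?_
  have := h c y
  split_ifs <;> simp_all

lemma sentProb_exists_le {κ : Type*} (s : Finset κ)
    (E : κ → (ι → Fin N → X) → (Fin N → Y) → Prop) :
    sentProb ch p W (fun c y => ∃ k ∈ s, E k c y) ≤ ∑ k ∈ s, sentProb ch p W (E k) := by
  classical
  unfold sentProb
  rw [← sentAvg_sum]
  refine sentAvg_mono ch p W fun c y => ?_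
  split_ifs with h
  · obtain ⟨k, hk, hE⟩ := h
    have := Finset.single_le_sum (f := fun k => if E k c y then (1 : ℝ) else 0)
      (fun i _ => by positivity) hk
    simpa only [if_pos hE] using this
  · positivity

lemma sentProb_add_sentProb_not (E : (ι → Fin N → X) → (Fin N → Y) → Prop) :
    sentProb ch p W E + sentProb ch p W (fun c y => ¬ E c y) = 1 := by
  classical
  unfold sentProb
  rw [← sentAvg_add]
  refine Eq.trans ?_ (sentAvg_one ch p W (N := N))
  congr 1
  ext c y
  by_cases h : E c y <;> simp [h]

open Classical in
lemma sentProb_cross_le {V : ι} (hVW : V ≠ W) (E : (Fin N → X) → (Fin N → Y) → Prop) {b : ℝ}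
    (h : ∀ y, ∑ x : Fin N → X, (∏ j, p V (x j)) * (if E x y then 1 else 0) ≤ b) :
    sentProb ch p W (fun c y => E (c V) y) ≤ b :=
  sentAvg_cross_le ch p W hVW (fun x y => if E x y then 1 else 0) h

/-- Chebyshev's inequality for the sum of a function of channel input and output. -/
lemma sentProb_chebyshev (f : X × Y → ℝ) {a : ℝ} (ha : 0 < a)
    (E : (Fin N → X) → (Fin N → Y) → Prop)
    (hE : ∀ x y, E x y → (∀ j, jointDist ch (p W) (x j, y j) ≠ 0) →
      a ^ 2 ≤ (∑ j, f (x j, y j) - N * ∑ z, jointDist ch (p W) z * f z) ^ 2) :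
    sentProb ch p W (fun c y => E (c W) y) ≤
      N * (∑ z, jointDist ch (p W) z * f z ^ 2) / a ^ 2 := by
  classical
  unfold sentProb
  rw [sentAvg_own ch p W (fun x y => if E x y then 1 else 0)]
  exact chebyshev_iid (jointDist_nonneg ch (p W)) (sum_jointDist ch (p W)) f ha
    (fun z => E (fun j => (z j).1) (fun j => (z j).2)) fun z hz hz0 =>
      hE _ _ hz fun j => Finset.prod_ne_zero_iff.1 hz0 j (Finset.mem_univ j)

end

end Sending

/-! ### From integrals over the codebook library to finite sums -/

section Integral

variable {X Y : Type*} [Fintype X] [Fintype Y] {Rmax : ℝ}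

/-- The integrand takes finitely many values, one per codebook. The event of a given codebook is a
finite intersection of independent symbol events, so its probability is the product of the symbol
laws. -/
lemma RandomCodingScheme.integral_codebook {N : ℕ} {Θ : Type*} [MeasurableSpace Θ]
    (S : RandomCodingScheme X Rmax N Θ) (F : Codebook X Rmax N → ℝ) :
    ∫ θ, F (S.codebook θ) ∂S.γ = ∑ c, (∏ V, ∏ j, S.inputDist V (c V j)) * F c := by
  classical
  have := S.isProb
  have hset : ∀ c : Codebook X Rmax N, {θ | S.codebook θ = c} =
      ⋂ q ∈ (Finset.univ : Finset (Message Rmax N × Fin N)),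
        (fun θ => S.codebook θ q.1 q.2) ⁻¹' {c q.1 q.2} := by
    intro c
    ext θ
    simp [funext_iff]
  have hmeas : ∀ c : Codebook X Rmax N, MeasurableSet {θ | S.codebook θ = c} := by
    intro c
    rw [hset]
    exact Finset.measurableSet_biInter _ fun q _ => S.measurable_symbol q.1 q.2 _
  have hprob : ∀ c : Codebook X Rmax N, S.γ.real {θ | S.codebook θ = c} =
      ∏ V, ∏ j, S.inputDist V (c V j) := by
    intro c
    have h := S.indep.measure_inter_preimage_eq_mul Finset.univ
      (sets := fun q => {c q.1 q.2}) (fun _ _ => trivial)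
    rw [Measure.real, hset, h, ENNReal.toReal_prod, Fintype.prod_prod_type]
    exact Finset.prod_congr rfl fun V _ => Finset.prod_congr rfl fun j _ => S.law V j _
  have hF : ∀ θ, F (S.codebook θ) =
      ∑ c, ({θ | S.codebook θ = c}.indicator (fun _ => F c) θ) := by
    intro θ
    rw [Finset.sum_eq_single (S.codebook θ)]
    · simp
    · intro c _ hc
      simp [hc.symm]
    · simp
  simp_rw [hF]
  rw [integral_finsetSum _ fun c _ => (integrable_const _).indicator (hmeas c)]
  refine Finset.sum_congr rfl fun c _ => ?_
  rw [integral_indicator_const _ (hmeas c), hprob, smul_eq_mul]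

variable {Θ : ℕ → Type*} [∀ N, MeasurableSpace (Θ N)] (ch : X → stdSimplex ℝ Y)
  (S : ∀ N, RandomCodingScheme X Rmax N (Θ N)) (D : DecoderSeq X Y Rmax)

lemma errorProb_eq_sentProb (N : ℕ) (W : Message Rmax N) :
    errorProb ch S D N W =
      sentProb ch (S N).inputDist W (fun c y => D N c y ≠ some W) := by
  classical
  unfold errorProb sentProb sentAvg
  rw [(S N).integral_codebook (fun c => ∑ y : Fin N → Y, if D N c y = some W then 0
    else blockProb ch (c W) y)]
  refine Finset.sum_congr (by congr!) fun c _ => ?_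
  congr 1
  refine Finset.sum_congr rfl fun y _ => ?_
  by_cases h : D N c y = some W <;> simp [h]

lemma collisionProb_eq_sentProb (N : ℕ) (W : Message Rmax N) :
    collisionProb ch S D N W =
      sentProb ch (S N).inputDist W (fun c y => D N c y = none) := by
  classical
  unfold collisionProb sentProb sentAvg
  rw [(S N).integral_codebook (fun c => ∑ y : Fin N → Y, if D N c y = none
    then blockProb ch (c W) y else 0)]
  refine Finset.sum_congr (by congr!) fun c _ => ?_
  congr 1
  refine Finset.sum_congr rfl fun y _ => ?_
  by_cases h : D N c y = none <;> simp [h]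

lemma one_sub_collisionProb_eq_sentProb (N : ℕ) (W : Message Rmax N) :
    1 - collisionProb ch S D N W =
      sentProb ch (S N).inputDist W (fun c y => ¬ D N c y = none) := by
  rw [collisionProb_eq_sentProb, ← sentProb_add_sentProb_not ch (S N).inputDist W
    (fun c y => D N c y = none), add_sub_cancel_left]

end Integral

/-! ### Continuity of mutual information and concentration of the information density -/

section MutualInformation

variable {X Y : Type*} [Fintype X] [Fintype Y] (ch : X → stdSimplex ℝ Y)

lemma continuous_stdSimplex_apply {A : Type*} [Fintype A] (a : A) :
    Continuous fun p : stdSimplex ℝ A => p a :=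
  (continuous_apply a).comp continuous_subtype_val

lemma continuous_outputDist : Continuous fun p : stdSimplex ℝ X => outputDist ch p := by
  refine continuous_pi fun y => ?_
  unfold outputDist
  exact continuous_finsetSum _ fun x _ => (continuous_stdSimplex_apply x).mul continuous_const

lemma outputDist_pos_of_jointDist_ne_zero {p : stdSimplex ℝ X} {z : X × Y}
    (h : jointDist ch p z ≠ 0) : 0 < outputDist ch p z.2 :=
  ((jointDist_nonneg ch p z).lt_of_ne' h).trans_le
    (Finset.single_le_sum (f := fun x => p x * ch x z.2)
      (fun _ _ => mul_nonneg (stdSimplex.zero_le _ _) (stdSimplex.zero_le _ _))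
      (Finset.mem_univ z.1))

lemma channel_pos_of_jointDist_ne_zero {p : stdSimplex ℝ X} {z : X × Y}
    (h : jointDist ch p z ≠ 0) : 0 < ch z.1 z.2 :=
  (stdSimplex.zero_le _ _).lt_of_ne' (right_ne_zero_of_mul h)

lemma jointDist_le_outputDist (p : stdSimplex ℝ X) (z : X × Y) :
    jointDist ch p z ≤ outputDist ch p z.2 :=
  Finset.single_le_sum (f := fun x => p x * ch x z.2)
    (fun _ _ => mul_nonneg (stdSimplex.zero_le _ _) (stdSimplex.zero_le _ _))
    (Finset.mem_univ z.1)

lemma outputDist_le_one (p : stdSimplex ℝ X) (y : Y) : outputDist ch p y ≤ 1 := by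
  rw [← sum_outputDist ch p]
  exact Finset.single_le_sum (f := fun y => outputDist ch p y)
    (fun _ _ => outputDist_nonneg _ _ _) (Finset.mem_univ y)

lemma mutualInfo_eq_sum_jointDist (p : stdSimplex ℝ X) :
    mutualInfo ch p =
      ∑ z, jointDist ch p z * Real.logb 2 (ch z.1 z.2 / outputDist ch p z.2) := by
  rw [Fintype.sum_prod_type]
  rfl

lemma jointDist_mul_logb_div (p : stdSimplex ℝ X) (z : X × Y) :
    jointDist ch p z * Real.logb 2 (ch z.1 z.2 / outputDist ch p z.2) =
      jointDist ch p z * (Real.logb 2 (ch z.1 z.2) - Real.logb 2 (outputDist ch p z.2)) := by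
  by_cases h : jointDist ch p z = 0
  · simp [h]
  · rw [Real.logb_div (channel_pos_of_jointDist_ne_zero ch h).ne'
      (outputDist_pos_of_jointDist_ne_zero ch h).ne']

/-- This is I = H(Y) - H(Y|X): the conditional entropy is linear in the input distribution, and the
output entropy is continuous even where output probabilities vanish. -/
lemma continuous_mutualInfo : Continuous (mutualInfo ch) := by
  have h : mutualInfo ch = fun p =>
      ∑ x, ∑ y, p x * (ch x y * Real.logb 2 (ch x y)) +
        ∑ y, Real.negMulLog (outputDist ch p y) / Real.log 2 := by
    ext p
    rw [mutualInfo_eq_sum_jointDist, Finset.sum_congr rfl fun z _ => jointDist_mul_logb_div ch p z]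
    simp_rw [mul_sub, Finset.sum_sub_distrib, sub_eq_add_neg]
    congr 1
    · rw [Fintype.sum_prod_type]
      simp [jointDist, mul_assoc]
    · rw [Fintype.sum_prod_type, Finset.sum_comm, ← Finset.sum_neg_distrib]
      refine Finset.sum_congr rfl fun y _ => ?_
      simp only [jointDist]
      rw [← Finset.sum_mul, Real.negMulLog, Real.logb]
      rw [show ∑ x, p x * ch x y = outputDist ch p y from rfl]
      ring
  rw [h]
  refine Continuous.add ?_ ?_
  · exact continuous_finsetSum _ fun x _ => continuous_finsetSum _ fun y _ =>
      (continuous_stdSimplex_apply x).mul continuous_const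
  · exact continuous_finsetSum _ fun y _ => (Real.continuous_negMulLog.comp
      ((continuous_apply y).comp (continuous_outputDist ch))).div_const _

lemma mul_log_sq_le_four {t : ℝ} (h0 : 0 ≤ t) (h1 : t ≤ 1) : t * Real.log t ^ 2 ≤ 4 := by
  rcases h0.eq_or_lt with rfl | h0
  · simp
  -- Squaring |u log u| < 1 at u = √t gives t (log t)^2 / 4 < 1.
  have h := Real.abs_log_mul_self_lt (√t) (Real.sqrt_pos.2 h0) (Real.sqrt_le_one.2 h1)
  have h2 : (Real.log √t * √t) ^ 2 < 1 := by
    rw [← sq_abs]; exact pow_lt_one₀ (abs_nonneg _) h two_ne_zero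
  rw [mul_pow, Real.sq_sqrt h0.le, Real.log_sqrt h0.le] at h2
  nlinarith

/-- The information density has second moment bounded uniformly in the input distribution. -/
lemma sum_jointDist_mul_logb_sq_le (p : stdSimplex ℝ X) :
    ∑ z, jointDist ch p z * Real.logb 2 (ch z.1 z.2 / outputDist ch p z.2) ^ 2 ≤
      (Fintype.card (X × Y) : ℝ) * (16 / Real.log 2 ^ 2) := by
  have hl : 0 < Real.log 2 := Real.log_pos one_lt_two
  rw [← nsmul_eq_mul, ← Finset.card_univ]
  refine Finset.sum_le_card_nsmul _ _ _ fun z _ => ?_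
  by_cases h : jointDist ch p z = 0
  · rw [h, zero_mul]; positivity
  have hc := channel_pos_of_jointDist_ne_zero ch h
  have hQ := outputDist_pos_of_jointDist_ne_zero ch h
  have h1 := mul_log_sq_le_four hc.le (stdSimplex.le_one (ch z.1) z.2)
  have h2 := mul_log_sq_le_four hQ.le (outputDist_le_one ch p z.2)
  rw [Real.logb, div_pow, ← mul_div_assoc, Real.log_div hc.ne' hQ.ne']
  gcongr
  have h3 : jointDist ch p z * Real.log (ch z.1 z.2) ^ 2 ≤ 4 := by
    refine le_trans ?_ h1
    refine mul_le_mul_of_nonneg_right ?_ (sq_nonneg _)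
    exact mul_le_of_le_one_left hc.le (stdSimplex.le_one _ _)
  have h4 : jointDist ch p z * Real.log (outputDist ch p z.2) ^ 2 ≤ 4 :=
    (mul_le_mul_of_nonneg_right (jointDist_le_outputDist ch p z) (sq_nonneg _)).trans h2
  have h5 := jointDist_nonneg ch p z
  -- (a - b)^2 = 2a^2 + 2b^2 - (a + b)^2, and each weighted square is at most 4; hence the constant
  -- 16.
  nlinarith [mul_nonneg h5
    (sq_nonneg (Real.log (ch z.1 z.2) + Real.log (outputDist ch p z.2)))]

/-- The codeword sent beats every likelihood threshold below the mutual information. -/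
lemma sentProb_likelihood_fail_le {ι : Type*} [Fintype ι]
    (p : ι → stdSimplex ℝ X) {N : ℕ} (hN : 0 < N) (W : ι) {t ε : ℝ} (hε : 0 < ε)
    (htI : Real.logb 2 t ≤ N * (mutualInfo ch (p W) - ε))
    (E : (Fin N → X) → (Fin N → Y) → Prop)
    (hE : ∀ x y, E x y → blockProb ch x y ≤ t * ∏ j, outputDist ch (p W) (y j)) :
    sentProb ch p W (fun c y => E (c W) y) ≤
      (Fintype.card (X × Y) : ℝ) * (16 / Real.log 2 ^ 2) / (N * ε ^ 2) := by
  have hN' : (0 : ℝ) < N := by exact_mod_cast hN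
  refine (sentProb_chebyshev ch p W
    (fun z => Real.logb 2 (ch z.1 z.2 / outputDist ch (p W) z.2)) (a := N * ε) (by positivity)
    E ?_).trans ?_
  · intro x y hxy hz
    have hc : ∀ j, 0 < ch (x j) (y j) := fun j => channel_pos_of_jointDist_ne_zero ch (hz j)
    have hQ : ∀ j, 0 < outputDist ch (p W) (y j) := fun j =>
      outputDist_pos_of_jointDist_ne_zero ch (hz j)
    rw [← mutualInfo_eq_sum_jointDist,
      ← Real.logb_prod _ _ (fun j _ => (div_pos (hc j) (hQ j)).ne'), Finset.prod_div_distrib]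
    have h1 : Real.logb 2 ((∏ j, ch (x j) (y j)) / ∏ j, outputDist ch (p W) (y j)) ≤
        Real.logb 2 t := by
      have hb : 0 < ∏ j, ch (x j) (y j) := Finset.prod_pos fun j _ => hc j
      have hq : 0 < ∏ j, outputDist ch (p W) (y j) := Finset.prod_pos fun j _ => hQ j
      refine Real.logb_le_logb_of_le one_lt_two (div_pos hb hq) ?_
      rw [div_le_iff₀ hq]
      exact hE _ _ hxy
    have h2 : 0 < N * ε := by positivity
    nlinarith
  · calc _ ≤ N * ((Fintype.card (X × Y) : ℝ) * (16 / Real.log 2 ^ 2)) / (N * ε) ^ 2 := by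
          gcongr
          exact sum_jointDist_mul_logb_sq_le ch (p W)
      _ = _ := by field_simp

end MutualInformation

/-! ### Messages and their rates -/

section Rates

variable {Rmax : ℝ}

lemma stdRate_nonneg {N : ℕ} (W : Message Rmax N) : 0 ≤ stdRate W := by
  refine div_nonneg (Real.logb_nonneg one_lt_two ?_) (Nat.cast_nonneg _)
  exact_mod_cast (Finset.mem_Icc.1 W.2).1

lemma one_le_message {N : ℕ} (W : Message Rmax N) : 1 ≤ (W : ℕ) := (Finset.mem_Icc.1 W.2).1

lemma stdRate_le (hR : 0 ≤ Rmax) {N : ℕ} (W : Message Rmax N) : stdRate W ≤ Rmax := by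
  unfold stdRate
  rcases Nat.eq_zero_or_pos N with rfl | hN
  · simpa using hR
  have h : ((W : ℕ) : ℝ) ≤ (2 : ℝ) ^ ((N : ℝ) * Rmax) :=
    (Nat.le_floor_iff (by positivity)).1 (Finset.mem_Icc.1 W.2).2
  rw [div_le_iff₀ (by exact_mod_cast hN), Real.logb_le_iff_le_rpow one_lt_two
    (by exact_mod_cast one_le_message W)]
  exact h.trans_eq (by rw [mul_comm])

lemma stdRate_mem_Icc (hR : 0 ≤ Rmax) {N : ℕ} (W : Message Rmax N) :
    stdRate W ∈ Set.Icc 0 Rmax := ⟨stdRate_nonneg W, stdRate_le hR W⟩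

lemma stdRate_eq_zero_iff {N : ℕ} (hN : 0 < N) (W : Message Rmax N) :
    stdRate W = 0 ↔ (W : ℕ) = 1 := by
  have hN' : (N : ℝ) ≠ 0 := by exact_mod_cast hN.ne'
  have h1 : (1 : ℝ) ≤ (W : ℕ) := by exact_mod_cast one_le_message W
  unfold stdRate
  rw [div_eq_zero_iff, or_iff_left hN', Real.logb_eq_zero]
  constructor
  · intro h
    have : ((W : ℕ) : ℝ) = 1 := by
      rcases h with h | h | h | h | h | h <;> linarith
    exact_mod_cast this
  · intro h; simp [h]

/-- The message number `1`, of rate zero. -/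
noncomputable def zeroMessage (hR : 0 ≤ Rmax) (N : ℕ) : Message Rmax N :=
  ⟨1, Finset.mem_Icc.2 ⟨le_rfl, Nat.le_floor (by
    rw [Nat.cast_one]; exact Real.one_le_rpow one_le_two (by positivity))⟩⟩

lemma eq_zeroMessage_iff (hR : 0 ≤ Rmax) {N : ℕ} (W : Message Rmax N) :
    W = zeroMessage hR N ↔ (W : ℕ) = 1 := Subtype.ext_iff

lemma stdRate_zeroMessage (hR : 0 ≤ Rmax) (N : ℕ) : stdRate (zeroMessage hR N) = 0 := by
  simp [stdRate, zeroMessage]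

/-- Every rate is the limit of the rates of a sequence of messages. -/
lemma exists_message_seq_tendsto {s : ℝ} (hs : s ∈ Set.Icc 0 Rmax) :
    ∃ W : ∀ N, Message Rmax N, Tendsto (fun N => stdRate (W N)) atTop (𝓝 s) := by
  have h1 : ∀ N : ℕ, (1 : ℝ) ≤ 2 ^ ((N : ℝ) * s) := fun N =>
    Real.one_le_rpow one_le_two (mul_nonneg (Nat.cast_nonneg _) hs.1)
  refine ⟨fun N => ⟨⌊(2 : ℝ) ^ ((N : ℝ) * s)⌋₊, Finset.mem_Icc.2
    ⟨Nat.le_floor (by simpa using h1 N), Nat.floor_mono ?_⟩⟩, ?_⟩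
  · exact Real.rpow_le_rpow_of_exponent_le one_le_two
      (mul_le_mul_of_nonneg_left hs.2 (Nat.cast_nonneg _))
  -- Rounding a number x ≥ 1 down loses at most a factor 2, that is 1/N in rate.
  have hlim : Tendsto (fun N : ℕ => s - 1 / (N : ℝ)) atTop (𝓝 s) := by
    simpa using tendsto_const_nhds.sub (tendsto_one_div_atTop_nhds_zero_nat (𝕜 := ℝ))
  refine tendsto_of_tendsto_of_tendsto_of_le_of_le' hlim tendsto_const_nhds ?_ ?_
  · filter_upwards [eventually_gt_atTop 0] with N hN
    have hN' : (0 : ℝ) < N := by exact_mod_cast hN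
    have hf1 : (1 : ℝ) ≤ ⌊(2 : ℝ) ^ ((N : ℝ) * s)⌋₊ := by
      exact_mod_cast Nat.le_floor (by simpa using h1 N)
    have hf2 := Nat.lt_floor_add_one ((2 : ℝ) ^ ((N : ℝ) * s))
    rw [stdRate, le_div_iff₀ hN', Real.le_logb_iff_rpow_le one_lt_two (by positivity)]
    rw [show (s - 1 / (N : ℝ)) * N = N * s - 1 by field_simp, Real.rpow_sub two_pos,
      Real.rpow_one]
    linarith
  · filter_upwards [eventually_gt_atTop 0] with N hN
    have hN' : (0 : ℝ) < N := by exact_mod_cast hN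
    have hf1 : (1 : ℝ) ≤ ⌊(2 : ℝ) ^ ((N : ℝ) * s)⌋₊ := by
      exact_mod_cast Nat.le_floor (by simpa using h1 N)
    rw [stdRate, div_le_iff₀ hN', Real.logb_le_iff_le_rpow one_lt_two (by positivity), mul_comm s]
    exact Nat.floor_le (by positivity)

end Rates

/-! ### Uniformity over all messages of the convergence of input distributions -/

section Follows

variable {X : Type*} [Fintype X] {Rmax : ℝ} {Θ : ℕ → Type*} [∀ N, MeasurableSpace (Θ N)]
  {S : ∀ N, RandomCodingScheme X Rmax N (Θ N)} {P : ℝ → stdSimplex ℝ X}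

/-- Following an asymptotic input distribution is uniform over all messages. -/
lemma FollowsAsymptotically.eventually_dist_lt (hS : FollowsAsymptotically S P) (hR : 0 ≤ Rmax)
    {ε : ℝ} (hε : 0 < ε) :
    ∀ᶠ N in atTop, ∀ W : Message Rmax N, dist ((S N).inputDist W) (P (stdRate W)) < ε := by
  classical
  by_contra hcon
  have hfreq : ∃ᶠ N in atTop, ∃ W : Message Rmax N,
      ε ≤ dist ((S N).inputDist W) (P (stdRate W)) := by
    rw [not_eventually] at hcon
    exact hcon.mono fun N h => by push Not at h; exact h
  obtain ⟨φ, hφ, hbad⟩ := extraction_of_frequently_atTop hfreq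
  let B : ∀ N, Message Rmax N := fun N =>
    if h : ∃ W : Message Rmax N, ε ≤ dist ((S N).inputDist W) (P (stdRate W)) then h.choose
    else zeroMessage hR N
  have hB : ∀ n, ε ≤ dist ((S (φ n)).inputDist (B (φ n))) (P (stdRate (B (φ n)))) := by
    intro n
    simp only [B, dif_pos (hbad n)]
    exact (hbad n).choose_spec
  obtain ⟨s, hs, ψ, hψ, hlim⟩ := isCompact_Icc.tendsto_subseq
    (fun n => stdRate_mem_Icc hR (B (φ n)))
  obtain ⟨V, hV⟩ := exists_message_seq_tendsto hs
  -- The hypothesis speaks of full sequences, so the bad messages along the subsequence are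
  -- completed by messages with the same limiting rate.
  let T : ∀ N, Message Rmax N := fun N => if N ∈ Set.range (φ ∘ ψ) then B N else V N
  have hφψ : StrictMono (φ ∘ ψ) := hφ.comp hψ
  have hT : Tendsto (fun N => stdRate (T N)) atTop (𝓝 s) := by
    rw [Metric.tendsto_atTop] at hV hlim ⊢
    intro δ hδ
    obtain ⟨N₁, h₁⟩ := hV δ hδ
    obtain ⟨K, hK⟩ := hlim δ hδ
    refine ⟨max N₁ (φ (ψ K)), fun N hN => ?_⟩
    by_cases h : N ∈ Set.range (φ ∘ ψ)
    · simp only [T, if_pos h]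
      obtain ⟨k, rfl⟩ := h
      exact hK k (hφψ.le_iff_le.1 ((le_max_right _ _).trans hN))
    · simp only [T, if_neg h]
      exact h₁ N ((le_max_left _ _).trans hN)
  have hev : ∀ᶠ N in atTop, dist ((S N).inputDist (T N)) (P (stdRate (T N))) < ε := by
    have := fun x => (Metric.tendsto_nhds.1 (hS T ⟨s, hT⟩ x)) ε hε
    filter_upwards [eventually_all.2 this] with N hN
    rw [Subtype.dist_eq, dist_pi_lt_iff hε]
    intro x
    have := hN x
    rwa [Real.dist_eq, sub_zero] at this
  obtain ⟨k, hk⟩ := (hφψ.tendsto_atTop.eventually hev).exists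
  have hTk : T ((φ ∘ ψ) k) = B ((φ ∘ ψ) k) := if_pos ⟨k, rfl⟩
  rw [hTk] at hk
  exact absurd (hB (ψ k)) (not_le.2 hk)

/-- The simplex is compact, so `g` is uniformly continuous; this needs no continuity of `P`. It is
applied to mutual information, output laws and `crossInfo`. -/
lemma FollowsAsymptotically.eventually_dist_comp_lt (hS : FollowsAsymptotically S P)
    (hR : 0 ≤ Rmax) {E : Type*} [PseudoMetricSpace E] {g : stdSimplex ℝ X → E}
    (hg : Continuous g) {ε : ℝ} (hε : 0 < ε) :
    ∀ᶠ N in atTop, ∀ W : Message Rmax N,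
      dist (g ((S N).inputDist W)) (g (P (stdRate W))) < ε := by
  obtain ⟨δ, hδ, h⟩ := Metric.uniformContinuous_iff.1
    (CompactSpace.uniformContinuous_of_continuous hg) ε hε
  filter_upwards [hS.eventually_dist_lt hR hδ] with N hN W using h (hN W)

end Follows

/-! ### The threshold decoder and achievability -/

section Decoder

variable {X Y : Type*} [Fintype X] [Fintype Y] {Rmax : ℝ}

/-- The likelihood of the output given the codeword `x` of message `V` exceeds its probability under
the input distribution of `V` by a factor of more than `V * (N + 1) ^ 2`. -/
def LikelihoodTest (ch : X → stdSimplex ℝ Y) {N : ℕ} (p : Message Rmax N → stdSimplex ℝ X)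
    (V : Message Rmax N) (x : Fin N → X) (y : Fin N → Y) : Prop :=
  ((V : ℕ) : ℝ) * ((N : ℝ) + 1) ^ 2 * ∏ j, outputDist ch (p V) (y j) < blockProb ch x y

lemma message_cast_pos {N : ℕ} (V : Message Rmax N) : (0 : ℝ) < ((V : ℕ) : ℝ) :=
  Nat.cast_pos.2 (one_le_message V)

lemma sentProb_likelihoodTest_cross_le (ch : X → stdSimplex ℝ Y) {N : ℕ}
    (p : Message Rmax N → stdSimplex ℝ X) {V W : Message Rmax N} (hVW : V ≠ W) :
    sentProb ch p W (fun c y => LikelihoodTest ch p V (c V) y) ≤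
      1 / (((V : ℕ) : ℝ) * ((N : ℝ) + 1) ^ 2) := by
  classical
  have hV := message_cast_pos V
  exact sentProb_cross_le ch p W hVW (fun x y => LikelihoodTest ch p V x y)
    fun y => sum_weight_likelihood_le ch (p V) (by positivity) y
      (fun x => LikelihoodTest ch p V x y) fun x hx => hx

/-- The harmonic sum up to 2^(N Rmax) is at most 1 + N Rmax log 2, and log 2 < 1. The growth is only
linear in N, so a factor (N+1)^2 in the test beats it. -/
lemma sum_message_inv_le (hR : 0 ≤ Rmax) (N : ℕ) :
    ∑ V : Message Rmax N, 1 / ((V : ℕ) : ℝ) ≤ 1 + N * Rmax := by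
  rw [Finset.sum_coe_sort (Finset.Icc 1 ⌊(2 : ℝ) ^ ((N : ℝ) * Rmax)⌋₊) (fun n : ℕ => 1 / (n : ℝ))]
  have h1 : (1 : ℝ) ≤ 2 ^ ((N : ℝ) * Rmax) := Real.one_le_rpow one_le_two (by positivity)
  have h2 : (0 : ℝ) < ⌊(2 : ℝ) ^ ((N : ℝ) * Rmax)⌋₊ := by
    exact_mod_cast Nat.le_floor (by simpa using h1)
  have h := harmonic_le_one_add_log ⌊(2 : ℝ) ^ ((N : ℝ) * Rmax)⌋₊
  rw [harmonic_eq_sum_Icc] at h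
  push_cast at h
  simp_rw [one_div]
  refine h.trans (add_le_add_right ?_ 1)
  calc Real.log ⌊(2 : ℝ) ^ ((N : ℝ) * Rmax)⌋₊ ≤ Real.log ((2 : ℝ) ^ ((N : ℝ) * Rmax)) :=
        Real.log_le_log h2 (Nat.floor_le (by positivity))
    _ = N * Rmax * Real.log 2 := Real.log_rpow two_pos _
    _ ≤ N * Rmax * 1 := by
        gcongr
        linarith [Real.log_two_lt_d9]
    _ = N * Rmax := mul_one _

/-- The probability that some message other than the one sent passes its likelihood test. -/
lemma sentProb_exists_likelihoodTest_le (ch : X → stdSimplex ℝ Y) (hR : 0 ≤ Rmax) {N : ℕ}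
    (p : Message Rmax N → stdSimplex ℝ X) (W : Message Rmax N) :
    sentProb ch p W (fun c y => ∃ V, V ≠ W ∧ LikelihoodTest ch p V (c V) y) ≤
      (1 + N * Rmax) / ((N : ℝ) + 1) ^ 2 := by
  classical
  calc _ = sentProb ch p W (fun c y => ∃ V ∈ Finset.univ.erase W,
        LikelihoodTest ch p V (c V) y) := by simp only [Finset.mem_erase, Finset.mem_univ, and_true]
    _ ≤ ∑ V ∈ Finset.univ.erase W, sentProb ch p W (fun c y => LikelihoodTest ch p V (c V) y) :=
        sentProb_exists_le ch p W _ _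
    _ ≤ ∑ V ∈ Finset.univ.erase W, 1 / (((V : ℕ) : ℝ) * ((N : ℝ) + 1) ^ 2) :=
        Finset.sum_le_sum fun V hV =>
          sentProb_likelihoodTest_cross_le ch p (Finset.ne_of_mem_erase hV)
    _ ≤ ∑ V : Message Rmax N, 1 / (((V : ℕ) : ℝ) * ((N : ℝ) + 1) ^ 2) := by
        refine Finset.sum_le_sum_of_subset_of_nonneg (Finset.erase_subset _ _) fun V _ _ => ?_
        positivity
    _ = (∑ V : Message Rmax N, 1 / ((V : ℕ) : ℝ)) / ((N : ℝ) + 1) ^ 2 := by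
        rw [Finset.sum_div]
        exact Finset.sum_congr rfl fun V _ => by rw [div_div]
    _ ≤ _ := by
        gcongr
        exact sum_message_inv_le hR N

lemma tendsto_collision_bound (R : ℝ) :
    Tendsto (fun N : ℕ => (1 + N * R) / ((N : ℝ) + 1) ^ 2) atTop (𝓝 0) := by
  have h1 := tendsto_one_div_add_atTop_nhds_zero_nat (𝕜 := ℝ)
  have h2 : (fun N : ℕ => (1 + N * R) / ((N : ℝ) + 1) ^ 2) =
      fun N : ℕ => R * (1 / ((N : ℝ) + 1)) + (1 - R) * (1 / ((N : ℝ) + 1) * (1 / ((N : ℝ) + 1))) := by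
    ext N
    have : (N : ℝ) + 1 ≠ 0 := by positivity
    field_simp
    ring
  rw [h2]
  simpa using (h1.const_mul R).add ((h1.mul h1).const_mul (1 - R))

lemma eventually_logb_le {ε : ℝ} (hε : 0 < ε) :
    ∀ᶠ N : ℕ in atTop, Real.logb 2 (((N : ℝ) + 1) ^ 2) ≤ N * ε := by
  have hl : 0 < Real.log 2 := Real.log_pos one_lt_two
  -- With offset -1 in the denominator and argument N + 1, the quotient is log(N+1)/N.
  have h := (Real.tendsto_pow_log_div_mul_add_atTop 1 (-1) 1 one_ne_zero).comp
    (tendsto_atTop_add_const_right atTop 1 (tendsto_natCast_atTop_atTop (R := ℝ)))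
  have h2 := h.eventually (gt_mem_nhds (show 0 < ε * Real.log 2 / 2 by positivity))
  filter_upwards [h2, eventually_gt_atTop 0] with N hN hN0
  have hN' : (0 : ℝ) < N := by exact_mod_cast hN0
  simp only [Function.comp, pow_one, one_mul, add_neg_cancel_right] at hN
  rw [div_lt_iff₀ hN'] at hN
  rw [Real.logb_pow, Real.logb, ← mul_div_assoc, div_le_iff₀ hl]
  push_cast
  nlinarith

/-- Messages of nonzero rate in the region `R` that pass their likelihood test. -/
def IsCandidate (R : Set ℝ) (ch : X → stdSimplex ℝ Y) {N : ℕ}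
    (p : Message Rmax N → stdSimplex ℝ X) (c : Codebook X Rmax N) (y : Fin N → Y)
    (V : Message Rmax N) : Prop :=
  (V : ℕ) ≠ 1 ∧ stdRate V ∈ R ∧ LikelihoodTest ch p V (c V) y

open Classical in
/-- The decoder outputs the unique candidate, message `1` if there is no candidate and `T` accepts
the output, and reports a collision otherwise. -/
noncomputable def thresholdDecoder (hR : 0 ≤ Rmax) (R : Set ℝ) (ch : X → stdSimplex ℝ Y)
    (p : ∀ N, Message Rmax N → stdSimplex ℝ X)
    (T : ∀ N, (Fin N → X) → (Fin N → Y) → Prop) : DecoderSeq X Y Rmax := fun N c y =>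
  if h : ∃! V, IsCandidate R ch (p N) c y V then some h.choose
  else if (¬ ∃ V, IsCandidate R ch (p N) c y V) ∧ T N (c (zeroMessage hR N)) y then
    some (zeroMessage hR N)
  else none

section

variable {hR : 0 ≤ Rmax} {R : Set ℝ} {ch : X → stdSimplex ℝ Y}
  {p : ∀ N, Message Rmax N → stdSimplex ℝ X} {T : ∀ N, (Fin N → X) → (Fin N → Y) → Prop}
  {N : ℕ} {c : Codebook X Rmax N} {y : Fin N → Y}

lemma thresholdDecoder_eq_some {W : Message Rmax N} (hW1 : (W : ℕ) ≠ 1) (hWR : stdRate W ∈ R)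
    (h1 : ¬ ∃ V, V ≠ W ∧ LikelihoodTest ch (p N) V (c V) y)
    (h2 : LikelihoodTest ch (p N) W (c W) y) :
    thresholdDecoder hR R ch p T N c y = some W := by
  have hu : ∃! V, IsCandidate R ch (p N) c y V :=
    ⟨W, ⟨hW1, hWR, h2⟩, fun V hV => by_contra fun hne => h1 ⟨V, hne, hV.2.2⟩⟩
  rw [thresholdDecoder, dif_pos hu]
  exact congrArg some (hu.unique hu.choose_spec.1 ⟨hW1, hWR, h2⟩)

lemma thresholdDecoder_eq_zeroMessage
    (h1 : ¬ ∃ V, V ≠ zeroMessage hR N ∧ LikelihoodTest ch (p N) V (c V) y)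
    (h2 : T N (c (zeroMessage hR N)) y) :
    thresholdDecoder hR R ch p T N c y = some (zeroMessage hR N) := by
  have hn : ¬ ∃ V, IsCandidate R ch (p N) c y V := fun ⟨V, hV⟩ =>
    h1 ⟨V, fun h => hV.1 ((eq_zeroMessage_iff hR V).1 h), hV.2.2⟩
  rw [thresholdDecoder, dif_neg fun h => hn h.exists, if_pos ⟨hn, h2⟩]

lemma thresholdDecoder_eq_none {W : Message Rmax N} (hWR : stdRate W ∉ R)
    (h1 : ¬ ∃ V, V ≠ W ∧ LikelihoodTest ch (p N) V (c V) y)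
    (h2 : ¬ T N (c (zeroMessage hR N)) y) :
    thresholdDecoder hR R ch p T N c y = none := by
  have hn : ¬ ∃ V, IsCandidate R ch (p N) c y V := fun ⟨V, hV⟩ =>
    h1 ⟨V, fun h => hWR (h ▸ hV.2.1), hV.2.2⟩
  rw [thresholdDecoder, dif_neg fun h => hn h.exists, if_neg fun h => h2 h.2]

end

section

variable {Θ : ℕ → Type*} [∀ N, MeasurableSpace (Θ N)] (ch : X → stdSimplex ℝ Y)
  (S : ∀ N, RandomCodingScheme X Rmax N (Θ N)) (hR : 0 ≤ Rmax) (R : Set ℝ)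
  (T : ∀ N, (Fin N → X) → (Fin N → Y) → Prop)

lemma errorProb_thresholdDecoder_le {N : ℕ} {W : Message Rmax N} (hW1 : (W : ℕ) ≠ 1)
    (hWR : stdRate W ∈ R) :
    errorProb ch S (thresholdDecoder hR R ch (fun N => (S N).inputDist) T) N W ≤
      (1 + N * Rmax) / ((N : ℝ) + 1) ^ 2 + sentProb ch (S N).inputDist W
        (fun c y => ¬ LikelihoodTest ch (S N).inputDist W (c W) y) := by
  rw [errorProb_eq_sentProb]
  refine (sentProb_le_add ch _ W fun c y h => ?_).trans
    (add_le_add_left (sentProb_exists_likelihoodTest_le ch hR (S N).inputDist W) _)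
  by_contra! hcon
  exact h (thresholdDecoder_eq_some hW1 hWR (by push Not; exact hcon.1) hcon.2)

lemma errorProb_thresholdDecoder_zeroMessage_le (N : ℕ) :
    errorProb ch S (thresholdDecoder hR R ch (fun N => (S N).inputDist) T) N (zeroMessage hR N) ≤
      (1 + N * Rmax) / ((N : ℝ) + 1) ^ 2 + sentProb ch (S N).inputDist (zeroMessage hR N)
        (fun c y => ¬ T N (c (zeroMessage hR N)) y) := by
  rw [errorProb_eq_sentProb]
  refine (sentProb_le_add ch _ (zeroMessage hR N) fun c y h => ?_).trans
    (add_le_add_left (sentProb_exists_likelihoodTest_le ch hR (S N).inputDist (zeroMessage hR N)) _)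
  by_contra! hcon
  exact h (thresholdDecoder_eq_zeroMessage (by push Not; exact hcon.1) hcon.2)

/-- A sent message outside the region is never a candidate, so any output other than a collision
needs an unsent codeword passing its test or `T` accepting. -/
lemma one_sub_collisionProb_thresholdDecoder_le {N : ℕ} {W : Message Rmax N}
    (hWR : stdRate W ∉ R) :
    1 - collisionProb ch S (thresholdDecoder hR R ch (fun N => (S N).inputDist) T) N W ≤
      (1 + N * Rmax) / ((N : ℝ) + 1) ^ 2 + sentProb ch (S N).inputDist W
        (fun c y => T N (c (zeroMessage hR N)) y) := by
  rw [one_sub_collisionProb_eq_sentProb]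
  refine (sentProb_le_add ch _ W fun c y h => ?_).trans
    (add_le_add_left (sentProb_exists_likelihoodTest_le ch hR (S N).inputDist W) _)
  by_contra! hcon
  exact h (thresholdDecoder_eq_none hWR (by push Not; exact hcon.1) hcon.2)

/-- Failure of the likelihood test of the message sent, uniformly over messages. -/
lemma eventually_sentProb_not_likelihoodTest_le {P : ℝ → stdSimplex ℝ X}
    (hS : FollowsAsymptotically S P) (hR : 0 ≤ Rmax) {ε : ℝ} (hε : 0 < ε) :
    ∀ᶠ N in atTop, ∀ W : Message Rmax N, stdRate W < mutualInfo ch (P (stdRate W)) - ε →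
      sentProb ch (S N).inputDist W
        (fun c y => ¬ LikelihoodTest ch (S N).inputDist W (c W) y) ≤
      (Fintype.card (X × Y) : ℝ) * (16 / Real.log 2 ^ 2) / (N * (ε / 2) ^ 2) := by
  -- Of the back-off ε, a quarter pays for the change of input distribution and a quarter for the
  -- factor (N+1)^2; half remains for Chebyshev's inequality.
  filter_upwards [hS.eventually_dist_comp_lt hR (continuous_mutualInfo ch)
      (show 0 < ε / 4 by positivity), eventually_logb_le (show 0 < ε / 4 by positivity),
    eventually_gt_atTop 0] with N hN hlog hN0 W hW
  have hN' : (0 : ℝ) < N := by exact_mod_cast hN0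
  have hWpos := message_cast_pos W
  refine sentProb_likelihood_fail_le ch (S N).inputDist hN0 W
    (t := ((W : ℕ) : ℝ) * ((N : ℝ) + 1) ^ 2) (by positivity) ?_
    (fun x y => ¬ LikelihoodTest ch (S N).inputDist W x y) fun x y h => not_lt.1 h
  rw [Real.logb_mul hWpos.ne' (by positivity)]
  have h1 : Real.logb 2 ((W : ℕ) : ℝ) = N * stdRate W := by
    rw [stdRate, mul_div_cancel₀ _ hN'.ne']
  have h2 := (abs_lt.1 (Real.dist_eq _ _ ▸ hN W)).1
  rw [h1]
  nlinarith

lemma tendsto_const_div_natCast_mul (A B : ℝ) :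
    Tendsto (fun N : ℕ => A / (N * B)) atTop (𝓝 0) := by
  have := (tendsto_one_div_atTop_nhds_zero_nat (𝕜 := ℝ)).const_mul (A / B)
  simp only [mul_zero] at this
  refine this.congr fun N => ?_
  rw [div_mul_div_comm, mul_one, mul_comm B]

/-- A test of the rate-zero message that is reliable and that rejects transmissions outside the
region yields decoders as required for the achievability. -/
lemma exists_decoderSeq_of_zero_test {P : ℝ → stdSimplex ℝ X} (hS : FollowsAsymptotically S P)
    (hR : 0 ≤ Rmax)
    (hT0 : Tendsto (fun N => sentProb ch (S N).inputDist (zeroMessage hR N)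
        (fun c y => ¬ T N (c (zeroMessage hR N)) y)) atTop (𝓝 0))
    (hT1 : ∀ W : ∀ N, Message Rmax N,
      (∀ᶠ N in atTop, stdRate (W N) ∉ closure (standardRegion Rmax ch P)) →
      (∃ r, r ∉ closure (standardRegion Rmax ch P) ∧
        Tendsto (fun N => stdRate (W N)) atTop (𝓝 r)) →
      Tendsto (fun N => sentProb ch (S N).inputDist (W N)
        (fun c y => T N (c (zeroMessage hR N)) y)) atTop (𝓝 0)) :
    ∃ D : DecoderSeq X Y Rmax, ReliableWithBackoff ch S D P ∧
      CollisionOutside ch S D (standardRegion Rmax ch P) := by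
  refine ⟨thresholdDecoder hR (standardRegion Rmax ch P) ch (fun N => (S N).inputDist) T, ?_, ?_⟩
  · intro ε₁ hε₁ ε₂ hε₂
    rw [← eventually_atTop]
    have h1 := (tendsto_collision_bound Rmax).add (tendsto_const_div_natCast_mul
      ((Fintype.card (X × Y) : ℝ) * (16 / Real.log 2 ^ 2)) ((ε₂ / 2) ^ 2))
    have h2 := (tendsto_collision_bound Rmax).add hT0
    rw [add_zero] at h1 h2
    filter_upwards [eventually_sentProb_not_likelihoodTest_le ch S hS hR hε₂,
      h1.eventually (gt_mem_nhds hε₁), h2.eventually (gt_mem_nhds hε₁), eventually_gt_atTop 0]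
      with N hN h1 h2 hN0 W hW
    by_cases hW1 : (W : ℕ) = 1
    · rw [(eq_zeroMessage_iff hR W).2 hW1]
      exact (errorProb_thresholdDecoder_zeroMessage_le ch S hR _ T N).trans_lt h2
    · have hW2 := hW.resolve_left fun h => hW1 ((stdRate_eq_zero_iff hN0 W).1 h)
      refine (errorProb_thresholdDecoder_le ch S hR (standardRegion Rmax ch P) T hW1
        ⟨stdRate_mem_Icc hR W, Or.inr (by linarith)⟩).trans_lt ?_
      exact (add_le_add_right (hN W hW2) _).trans_lt h1
  · intro W hW hlim
    have h1 := (tendsto_collision_bound Rmax).add (hT1 W hW hlim)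
    rw [add_zero] at h1
    have h2 : Tendsto (fun N => 1 - collisionProb ch S (thresholdDecoder hR
        (standardRegion Rmax ch P) ch (fun N => (S N).inputDist) T) N (W N)) atTop (𝓝 0) := by
      refine tendsto_of_tendsto_of_tendsto_of_le_of_le' tendsto_const_nhds h1 ?_ ?_
      · refine Eventually.of_forall fun N => ?_
        rw [one_sub_collisionProb_eq_sentProb]
        exact sentProb_nonneg ch _ _ _
      · filter_upwards [hW] with N hN
        exact one_sub_collisionProb_thresholdDecoder_le ch S hR _ T
          fun h => hN (subset_closure h)
    simpa using h2.const_sub 1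

lemma zero_mem_standardRegion {P : ℝ → stdSimplex ℝ X} (hR : 0 ≤ Rmax) :
    0 ∈ standardRegion Rmax ch P := ⟨⟨le_rfl, hR⟩, Or.inl rfl⟩

/-- The rate 0 lies below I_0 with a fixed margin, so the likelihood test serves message 1 too.
Outside the region message 1 is unsent, and the test accepts with probability at most 1/(N+1)^2. -/
lemma exists_decoderSeq_of_mutualInfo_pos {P : ℝ → stdSimplex ℝ X}
    (hS : FollowsAsymptotically S P) (hR : 0 ≤ Rmax) (hI : 0 < mutualInfo ch (P 0)) :
    ∃ D : DecoderSeq X Y Rmax, ReliableWithBackoff ch S D P ∧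
      CollisionOutside ch S D (standardRegion Rmax ch P) := by
  classical
  refine exists_decoderSeq_of_zero_test ch S
    (fun N => LikelihoodTest ch (S N).inputDist (zeroMessage hR N)) hS hR ?_ ?_
  · refine tendsto_of_tendsto_of_tendsto_of_le_of_le' tendsto_const_nhds
      (tendsto_const_div_natCast_mul ((Fintype.card (X × Y) : ℝ) * (16 / Real.log 2 ^ 2))
        ((mutualInfo ch (P 0) / 2 / 2) ^ 2))
      (Eventually.of_forall fun N => sentProb_nonneg ch _ _ _) ?_
    filter_upwards [eventually_sentProb_not_likelihoodTest_le ch S hS hR (half_pos hI)] with N hN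
    refine hN _ ?_
    rw [stdRate_zeroMessage]
    linarith
  · intro W hW _
    refine tendsto_of_tendsto_of_tendsto_of_le_of_le' tendsto_const_nhds
      (tendsto_collision_bound 0)
      (Eventually.of_forall fun N => sentProb_nonneg ch _ _ _) ?_
    filter_upwards [hW] with N hN
    have hne : zeroMessage hR N ≠ W N := fun h => hN <| subset_closure <| by
      rw [← h, stdRate_zeroMessage]; exact zero_mem_standardRegion ch hR
    simpa [zeroMessage] using sentProb_likelihoodTest_cross_le ch (S N).inputDist hne

/-- Chebyshev's inequality for the number of occurrences of an output symbol. -/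
lemma sentProb_count_le {N : ℕ} (p : Message Rmax N → stdSimplex ℝ X) (W : Message Rmax N)
    [DecidableEq Y] (b : Y) {a : ℝ} (ha : 0 < a) (E : (Fin N → Y) → Prop)
    (hE : ∀ y, E y →
      a ^ 2 ≤ (∑ j, (if y j = b then (1 : ℝ) else 0) - N * outputDist ch (p W) b) ^ 2) :
    sentProb ch p W (fun _ y => E y) ≤ N / a ^ 2 := by
  have hmean : ∑ z, jointDist ch (p W) z * (if z.2 = b then (1 : ℝ) else 0) =
      outputDist ch (p W) b := by
    simp [Fintype.sum_prod_type, jointDist, outputDist]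
  refine (sentProb_chebyshev ch p W (fun z => if z.2 = b then 1 else 0) ha (fun _ y => E y)
    ?_).trans ?_
  · intro x y hy _
    rw [hmean]
    exact hE _ hy
  · have : ∑ z, jointDist ch (p W) z * (if z.2 = b then (1 : ℝ) else 0) ^ 2 ≤ 1 := by
      simp only [ite_pow, one_pow, zero_pow two_ne_zero]
      rw [hmean]
      exact outputDist_le_one ch _ _
    gcongr
    exact mul_le_of_le_one_right (Nat.cast_nonneg _) this

/-- The codeword of message 1 may carry no information, so the test ignores it and compares output
symbol counts with their expected values. -/
lemma exists_decoderSeq_of_outputDist_separated {P : ℝ → stdSimplex ℝ X}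
    (hS : FollowsAsymptotically S P) (hR : 0 ≤ Rmax)
    (hsep : ∀ s ∈ Set.Icc 0 Rmax, s ∉ closure (standardRegion Rmax ch P) →
      ∃ ε > 0, ∀ᶠ r in 𝓝[Set.Icc 0 Rmax] s,
        ∃ y, ε ≤ |outputDist ch (P r) y - outputDist ch (P 0) y|) :
    ∃ D : DecoderSeq X Y Rmax, ReliableWithBackoff ch S D P ∧
      CollisionOutside ch S D (standardRegion Rmax ch P) := by
  classical
  have hsqrt : Tendsto (fun N : ℕ => √(N : ℝ)) atTop atTop :=
    Real.tendsto_sqrt_atTop.comp tendsto_natCast_atTop_atTop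
  -- The allowed deviation is N^(3/4): above the √N fluctuations of the counts, yet below the order
  -- N by which separated output laws differ.
  refine exists_decoderSeq_of_zero_test ch S
    (fun N _ y => ∀ b, (∑ j, (if y j = b then (1 : ℝ) else 0) -
      N * outputDist ch ((S N).inputDist (zeroMessage hR N)) b) ^ 2 ≤ N * √N) hS hR ?_ ?_
  · have hb : Tendsto (fun N : ℕ => (Fintype.card Y : ℝ) * (√(N : ℝ))⁻¹) atTop (𝓝 0) := by
      simpa using (tendsto_inv_atTop_zero.comp hsqrt).const_mul (Fintype.card Y : ℝ)
    refine tendsto_of_tendsto_of_tendsto_of_le_of_le' tendsto_const_nhds hb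
      (Eventually.of_forall fun N => sentProb_nonneg ch _ _ _) ?_
    filter_upwards [eventually_gt_atTop 0] with N hN0
    have hN' : (0 : ℝ) < N := by exact_mod_cast hN0
    set W := zeroMessage hR N
    calc _ = sentProb ch (S N).inputDist W (fun _ y => ∃ b ∈ (Finset.univ : Finset Y),
          N * √N < (∑ j, (if y j = b then (1 : ℝ) else 0) -
            N * outputDist ch ((S N).inputDist W) b) ^ 2) := by
          simp only [not_forall, not_le, Finset.mem_univ, true_and]
          rfl
      _ ≤ ∑ b : Y, sentProb ch (S N).inputDist W (fun _ y =>
          N * √N < (∑ j, (if y j = b then (1 : ℝ) else 0) -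
            N * outputDist ch ((S N).inputDist W) b) ^ 2) :=
          sentProb_exists_le ch _ W Finset.univ _
      _ ≤ ∑ b : Y, (√(N : ℝ))⁻¹ := by
          refine Finset.sum_le_sum fun b _ => ?_
          have ha : (0 : ℝ) < N * √N := by positivity
          refine (sentProb_count_le ch (S N).inputDist W b (Real.sqrt_pos.2 ha) _
            fun y hy => ?_).trans ?_
          · rw [Real.sq_sqrt ha.le]
            exact hy.le
          · rw [Real.sq_sqrt ha.le]
            apply le_of_eq
            field_simp
      _ = _ := by simp
  · rintro W _ ⟨s, hs, hlim⟩
    have hsI : s ∈ Set.Icc 0 Rmax := isClosed_Icc.mem_of_tendsto hlim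
      (Eventually.of_forall fun N => stdRate_mem_Icc hR _)
    obtain ⟨ε, hε, hev⟩ := hsep s hsI hs
    have hlim' : Tendsto (fun N => stdRate (W N)) atTop (𝓝[Set.Icc 0 Rmax] s) :=
      tendsto_nhdsWithin_iff.2 ⟨hlim, Eventually.of_forall fun N => stdRate_mem_Icc hR _⟩
    refine tendsto_of_tendsto_of_tendsto_of_le_of_le' tendsto_const_nhds
      (tendsto_const_div_natCast_mul 1 ((ε / 4) ^ 2))
      (Eventually.of_forall fun N => sentProb_nonneg ch _ _ _) ?_
    -- Replacing both limiting output laws by those of the scheme leaves a separation ε/2. For √N >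
    -- 16/ε^2 the test tolerance is at most Nε/4, so acceptance forces a deviation of at least Nε/4
    -- from the mean under `W N`.
    filter_upwards [hlim'.eventually hev, hS.eventually_dist_comp_lt hR
      (continuous_outputDist ch) (show 0 < ε / 4 by positivity), eventually_gt_atTop 0,
      hsqrt.eventually_gt_atTop (16 / ε ^ 2)] with N hsepN hdist hN0 hbig
    have hN' : (0 : ℝ) < N := by exact_mod_cast hN0
    obtain ⟨b, hb⟩ := hsepN
    refine (sentProb_count_le ch (S N).inputDist (W N) b (a := N * (ε / 4)) (by positivity) _
      fun y hy => ?_).trans ?_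
    · have h1 : |outputDist ch ((S N).inputDist (W N)) b - outputDist ch (P (stdRate (W N))) b|
          < ε / 4 := by
        rw [← Real.dist_eq]; exact (dist_le_pi_dist _ _ b).trans_lt (hdist _)
      have h2 : |outputDist ch ((S N).inputDist (zeroMessage hR N)) b - outputDist ch (P 0) b|
          < ε / 4 := by
        have := hdist (zeroMessage hR N)
        rw [stdRate_zeroMessage] at this
        rw [← Real.dist_eq]; exact (dist_le_pi_dist _ _ b).trans_lt this
      have h3 : ε / 2 ≤ |outputDist ch ((S N).inputDist (W N)) b -
          outputDist ch ((S N).inputDist (zeroMessage hR N)) b| := by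
        rw [abs_lt] at h1 h2
        rw [le_abs] at hb ⊢
        rcases hb with hb | hb
        · left; linarith
        · right; linarith
      have h4 : N * √(N : ℝ) ≤ (N * (ε / 4)) ^ 2 := by
        rw [div_lt_iff₀ (by positivity)] at hbig
        have := Real.mul_self_sqrt hN'.le
        have hs : 0 ≤ √(N : ℝ) := Real.sqrt_nonneg _
        have : √(N : ℝ) ≤ N * (ε / 4) ^ 2 := by nlinarith
        nlinarith
      have h5 := abs_le_of_sq_le_sq ((hy b).trans h4) (by positivity)
      rw [sq_le_sq, abs_of_pos (show 0 < N * (ε / 4) by positivity)]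
      have h6 : N * (ε / 2) ≤ |N * outputDist ch ((S N).inputDist (W N)) b -
          N * outputDist ch ((S N).inputDist (zeroMessage hR N)) b| := by
        rw [← mul_sub, abs_mul, abs_of_pos hN']
        gcongr
      rw [abs_le] at h5
      rw [le_abs] at h6 ⊢
      rcases h6 with h6 | h6
      · right; linarith
      · left; linarith
    · apply le_of_eq
      field_simp

/-- A local margin lets one fixed back-off cover the tail of any sequence of rates converging in the
region. -/
lemma AsymptoticallyAchievable.of_reliableWithBackoff {P : ℝ → stdSimplex ℝ X}
    {D : DecoderSeq X Y Rmax} (hD : ReliableWithBackoff ch S D P)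
    (hC : CollisionOutside ch S D (standardRegion Rmax ch P))
    (hM : LocallyPositiveMargin Rmax ch P) :
    AsymptoticallyAchievable ch S (standardRegion Rmax ch P) := by
  classical
  refine ⟨D, fun W hW ⟨s, hs, hlim⟩ => ?_, hC⟩
  obtain ⟨ε, hε, hev⟩ := hM s hs
  have hev' := (tendsto_nhdsWithin_iff.2 ⟨hlim, hW⟩).eventually hev
  rw [Metric.tendsto_nhds]
  intro δ hδ
  obtain ⟨N₀, hN₀⟩ := hD δ hδ (ε / 2) (half_pos hε)
  filter_upwards [hev', eventually_ge_atTop N₀] with N h1 h2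
  have h3 : 0 ≤ errorProb ch S D N (W N) := by
    rw [errorProb_eq_sentProb]
    exact sentProb_nonneg ch _ _ _
  rw [Real.dist_eq, sub_zero, abs_of_nonneg h3]
  exact hN₀ N h2 (W N) (h1.imp_right fun h => by linarith)

end

end Decoder

/-! ### Converse: disjoint decoding sets and a block of messages of nearly equal rate -/

section Converse

variable {X Y : Type*} [Fintype X] [Fintype Y]

/-- The decoding regions are disjoint, so the output distribution `q` covers them only once. -/
lemma sum_sentProb_decode_le {ι : Type*} [Fintype ι] (ch : X → stdSimplex ℝ Y)
    (p : ι → stdSimplex ℝ X) {N : ℕ} (d : (ι → Fin N → X) → (Fin N → Y) → Option ι)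
    (B : Finset ι) {t : ℝ} (ht : 0 ≤ t) {q : Y → ℝ} (hq0 : ∀ y, 0 ≤ q y) (hq : ∑ y, q y = 1) :
    ∑ W ∈ B, sentProb ch p W (fun c y => d c y = some W) ≤
      ∑ W ∈ B, sentProb ch p W
        (fun c (y : Fin N → Y) => t * ∏ j, q (y j) < blockProb ch (c W) y) + t := by
  classical
  have hw : ∀ c : ι → Fin N → X, 0 ≤ ∏ V, ∏ j, p V (c V j) := fun c =>
    Finset.prod_nonneg fun _ _ => Finset.prod_nonneg fun _ _ => stdSimplex.zero_le _ _
  have hqN : ∀ y : Fin N → Y, 0 ≤ ∏ j, q (y j) := fun y => Finset.prod_nonneg fun _ _ => hq0 _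
  -- Where the likelihood is below the threshold, it is replaced by t times the reference law; the
  -- remaining outputs are charged to the first term.
  have h1 : ∀ W, sentProb ch p W (fun c y => d c y = some W) ≤
      sentProb ch p W (fun c (y : Fin N → Y) => t * ∏ j, q (y j) < blockProb ch (c W) y) +
      ∑ c : ι → Fin N → X, (∏ V, ∏ j, p V (c V j)) *
        ∑ y, t * (∏ j, q (y j)) * (if d c y = some W then 1 else 0) := by
    intro W
    unfold sentProb sentAvg
    rw [← Finset.sum_add_distrib]
    refine Finset.sum_le_sum fun c _ => ?_
    rw [← mul_add, ← Finset.sum_add_distrib]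
    refine mul_le_mul_of_nonneg_left (Finset.sum_le_sum fun y _ => ?_) (hw c)
    have hb := blockProb_nonneg ch (c W) y
    have htq := mul_nonneg ht (hqN y)
    by_cases hd : d c y = some W <;> by_cases hlt : t * ∏ j, q (y j) < blockProb ch (c W) y
    · simp only [hd, hlt, if_true]; linarith
    · simp only [hd, hlt, if_true, if_false]; linarith
    · simp only [hd, hlt, if_true, if_false]; linarith
    · simp only [hd, hlt, if_false]; linarith
  refine (Finset.sum_le_sum fun W _ => h1 W).trans ?_
  rw [Finset.sum_add_distrib]
  refine add_le_add_right ?_ _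
  rw [Finset.sum_comm]
  calc _ ≤ ∑ c : ι → Fin N → X, (∏ V, ∏ j, p V (c V j)) * t := by
        refine Finset.sum_le_sum fun c _ => ?_
        rw [← Finset.mul_sum, Finset.sum_comm]
        refine mul_le_mul_of_nonneg_left ?_ (hw c)
        calc _ ≤ ∑ y : Fin N → Y, t * ∏ j, q (y j) := by
              refine Finset.sum_le_sum fun y _ => ?_
              rw [← Finset.mul_sum]
              refine mul_le_of_le_one_right (mul_nonneg ht (hqN y)) ?_
              -- Each output is decoded to at most one message, so its reference mass is counted at
              -- most once.
              rcases hd : d c y with _ | V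
              · simp
              · simp only [Option.some.injEq, Finset.sum_ite_eq]
                split_ifs <;> simp
          _ = t := by rw [← Finset.mul_sum, sum_prod_weight hq, mul_one]
    _ = t := by
        rw [← Finset.sum_mul]
        rw [← Fintype.prod_sum (fun V (x : Fin N → X) => ∏ j, p V (x j))]
        simp [sum_prod_weight (stdSimplex.sum_eq_one (p _))]

/-- Mean of the information density with respect to a reference output distribution `q`. -/
noncomputable def crossInfo (ch : X → stdSimplex ℝ Y) (q : Y → ℝ) (p : stdSimplex ℝ X) : ℝ :=
  ∑ z, jointDist ch p z * Real.logb 2 (ch z.1 z.2 / q z.2)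

/-- With `q` fixed the logarithms are constants, so the mean is linear in the input distribution.
One reference law can thus serve the whole block of messages. -/
lemma continuous_crossInfo (ch : X → stdSimplex ℝ Y) (q : Y → ℝ) :
    Continuous (crossInfo ch q) := by
  unfold crossInfo jointDist
  exact continuous_finsetSum _ fun z _ =>
    ((continuous_stdSimplex_apply z.1).mul continuous_const).mul continuous_const

lemma jointDist_le_one (ch : X → stdSimplex ℝ Y) (p : stdSimplex ℝ X) (z : X × Y) :
    jointDist ch p z ≤ 1 :=
  (jointDist_le_outputDist ch p z).trans (outputDist_le_one ch p z.2)

lemma crossInfo_le (ch : X → stdSimplex ℝ Y) {q : Y → ℝ} (hq : ∀ y, 0 < q y)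
    {p : stdSimplex ℝ X} {a : ℝ} (h : ∀ y, (2 : ℝ) ^ (-a) * outputDist ch p y ≤ q y) :
    crossInfo ch q p ≤ mutualInfo ch p + a := by
  have h1 : ∀ z, jointDist ch p z * Real.logb 2 (ch z.1 z.2 / q z.2) ≤
      jointDist ch p z * Real.logb 2 (ch z.1 z.2 / outputDist ch p z.2) + jointDist ch p z * a := by
    intro z
    rw [← mul_add]
    by_cases hz : jointDist ch p z = 0
    · simp [hz]
    refine mul_le_mul_of_nonneg_left ?_ (jointDist_nonneg ch p z)
    have hc := channel_pos_of_jointDist_ne_zero ch hz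
    have hQ := outputDist_pos_of_jointDist_ne_zero ch hz
    have h2 := Real.logb_le_logb_of_le one_lt_two (by positivity) (h z.2)
    rw [Real.logb_mul (by positivity) hQ.ne', Real.logb_rpow two_pos (by norm_num)] at h2
    rw [Real.logb_div hc.ne' (hq _).ne', Real.logb_div hc.ne' hQ.ne']
    linarith
  refine (Finset.sum_le_sum fun z _ => h1 z).trans_eq ?_
  rw [Finset.sum_add_distrib, ← mutualInfo_eq_sum_jointDist, ← Finset.sum_mul, sum_jointDist,
    one_mul]

lemma sentProb_likelihood_gt_le {ι : Type*} [Fintype ι] (ch : X → stdSimplex ℝ Y)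
    (p : ι → stdSimplex ℝ X) {N : ℕ} (hN : 0 < N) (W : ι) {q : Y → ℝ} (hq : ∀ y, 0 < q y)
    {τ ε : ℝ} (hε : 0 < ε) (hG : crossInfo ch q (p W) ≤ τ - ε) :
    sentProb ch p W
        (fun c (y : Fin N → Y) => (2 : ℝ) ^ (N * τ) * ∏ j, q (y j) < blockProb ch (c W) y) ≤
      (∑ z : X × Y, Real.logb 2 (ch z.1 z.2 / q z.2) ^ 2) / (N * ε ^ 2) := by
  have hN' : (0 : ℝ) < N := by exact_mod_cast hN
  refine (sentProb_chebyshev ch p W (fun z => Real.logb 2 (ch z.1 z.2 / q z.2)) (a := N * ε)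
    (by positivity) (fun x y => (2 : ℝ) ^ (N * τ) * ∏ j, q (y j) < blockProb ch x y)
    fun x y hxy hz => ?_).trans ?_
  · have hc : ∀ j, 0 < ch (x j) (y j) := fun j => channel_pos_of_jointDist_ne_zero ch (hz j)
    rw [← Real.logb_prod _ _ (fun j _ => (div_pos (hc j) (hq _)).ne'), Finset.prod_div_distrib]
    have hqN : 0 < ∏ j, q (y j) := Finset.prod_pos fun j _ => hq _
    have h1 : N * τ ≤ Real.logb 2 ((∏ j, ch (x j) (y j)) / ∏ j, q (y j)) := by
      rw [Real.le_logb_iff_rpow_le one_lt_two (div_pos (Finset.prod_pos fun j _ => hc j) hqN),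
        le_div_iff₀ hqN]
      exact hxy.le
    change (N * ε) ^ 2 ≤ (_ - N * crossInfo ch q (p W)) ^ 2
    have h2 : N * ε ≤ N * τ - N * crossInfo ch q (p W) := by
      rw [← mul_sub]; gcongr; linarith
    exact pow_le_pow_left₀ (by positivity) (h2.trans (sub_le_sub_right h1 _)) 2
  · have : ∑ z, jointDist ch (p W) z * Real.logb 2 (ch z.1 z.2 / q z.2) ^ 2 ≤
        ∑ z : X × Y, Real.logb 2 (ch z.1 z.2 / q z.2) ^ 2 :=
      Finset.sum_le_sum fun z _ => mul_le_of_le_one_left (sq_nonneg _) (jointDist_le_one ch _ z)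
    calc _ ≤ N * (∑ z : X × Y, Real.logb 2 (ch z.1 z.2 / q z.2) ^ 2) / (N * ε) ^ 2 := by gcongr
      _ = _ := by field_simp

variable {Rmax : ℝ}

/-- The messages `W` with `⌈2 ^ (N * r)⌉ ≤ W < 2 * ⌈2 ^ (N * r)⌉`. -/
noncomputable def messageBlock (Rmax : ℝ) (N : ℕ) (r : ℝ) : Finset (Message Rmax N) :=
  Finset.univ.filter fun W =>
    ⌈(2 : ℝ) ^ ((N : ℝ) * r)⌉₊ ≤ (W : ℕ) ∧ (W : ℕ) < 2 * ⌈(2 : ℝ) ^ ((N : ℝ) * r)⌉₊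

/-- For x ≥ 1 the ceiling is below x + 1 ≤ 2x, so its double is at most 4x; this is where the width
2/N of the block in rate comes from. -/
lemma two_mul_ceil_le {N : ℕ} {r : ℝ} (hr : 0 ≤ r) :
    2 * (⌈(2 : ℝ) ^ ((N : ℝ) * r)⌉₊ : ℝ) ≤ 2 ^ ((N : ℝ) * r + 2) := by
  have h1 : (1 : ℝ) ≤ 2 ^ ((N : ℝ) * r) := Real.one_le_rpow one_le_two (by positivity)
  have h2 := Nat.ceil_lt_add_one (show (0 : ℝ) ≤ 2 ^ ((N : ℝ) * r) by positivity)
  rw [Real.rpow_add two_pos, Real.rpow_two]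
  linarith

lemma le_card_messageBlock {N : ℕ} {r : ℝ} (hr : 0 ≤ r)
    (h : (N : ℝ) * r + 2 ≤ N * Rmax) :
    (2 : ℝ) ^ ((N : ℝ) * r) ≤ (messageBlock Rmax N r).card := by
  set M := ⌈(2 : ℝ) ^ ((N : ℝ) * r)⌉₊ with hM
  have hMpos : 0 < M := Nat.ceil_pos.2 (by positivity)
  have hcard : (Finset.Ico M (2 * M)).card ≤ (messageBlock Rmax N r).card := by
    refine Finset.card_le_card_of_surjOn (fun W : Message Rmax N => (W : ℕ)) fun k hk => ?_
    have hk' := Finset.mem_Ico.1 (Finset.mem_coe.1 hk)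
    have hk2 : k ≤ ⌊(2 : ℝ) ^ ((N : ℝ) * Rmax)⌋₊ := by
      refine Nat.le_floor ?_
      calc (k : ℝ) ≤ 2 * (M : ℝ) := by exact_mod_cast hk'.2.le
        _ ≤ 2 ^ ((N : ℝ) * r + 2) := two_mul_ceil_le hr
        _ ≤ _ := Real.rpow_le_rpow_of_exponent_le one_le_two h
    exact ⟨⟨k, Finset.mem_Icc.2 ⟨by omega, hk2⟩⟩, 
      Finset.mem_coe.2 (Finset.mem_filter.2 ⟨Finset.mem_univ _, hk'⟩), rfl⟩
  rw [Nat.card_Ico, show 2 * M - M = M by omega] at hcard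
  exact (Nat.le_ceil _).trans (by exact_mod_cast hcard)

lemma stdRate_mem_of_mem_messageBlock {N : ℕ} (hN : 0 < N) {r : ℝ} (hr : 0 ≤ r)
    {W : Message Rmax N} (hW : W ∈ messageBlock Rmax N r) :
    stdRate W ∈ Set.Icc r (r + 2 / N) := by
  have hN' : (0 : ℝ) < N := by exact_mod_cast hN
  have hWpos := message_cast_pos W
  rw [messageBlock, Finset.mem_filter] at hW
  constructor
  · rw [stdRate, le_div_iff₀ hN', Real.le_logb_iff_rpow_le one_lt_two hWpos, mul_comm r]
    exact Nat.ceil_le.1 hW.2.1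
  · rw [stdRate, div_le_iff₀ hN', Real.logb_le_iff_le_rpow one_lt_two hWpos,
      show (r + 2 / N) * N = N * r + 2 by field_simp]
    refine le_trans ?_ (two_mul_ceil_le hr)
    exact_mod_cast hW.2.2.le

/-- Mixing the output law with a little of the uniform law makes it strictly positive, at a cost of
at most a bits in the information density. -/
lemma exists_pos_dist_of_le (ch : X → stdSimplex ℝ Y) (p : stdSimplex ℝ X) {a : ℝ} (ha : 0 < a) :
    ∃ q : Y → ℝ, (∀ y, 0 < q y) ∧ ∑ y, q y = 1 ∧
      ∀ y, (2 : ℝ) ^ (-a) * outputDist ch p y ≤ q y := by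
  have hY : Nonempty Y := by
    by_contra h
    rw [not_nonempty_iff] at h
    simpa using sum_outputDist ch p
  have h1 : (2 : ℝ) ^ (-a) < 1 := Real.rpow_lt_one_of_one_lt_of_neg one_lt_two (by linarith)
  have hc : (0 : ℝ) < Fintype.card Y := by exact_mod_cast Fintype.card_pos
  have hl : 0 < (1 - (2 : ℝ) ^ (-a)) / Fintype.card Y := div_pos (by linarith) hc
  refine ⟨fun y => (2 : ℝ) ^ (-a) * outputDist ch p y + (1 - (2 : ℝ) ^ (-a)) / Fintype.card Y,
    fun y => ?_, ?_, fun y => by linarith⟩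
  · have := outputDist_nonneg ch p y
    positivity
  · rw [Finset.sum_add_distrib, ← Finset.mul_sum, sum_outputDist]
    simp only [Finset.sum_const, Finset.card_univ, nsmul_eq_mul]
    field_simp
    ring

variable {Θ : ℕ → Type*} [∀ N, MeasurableSpace (Θ N)] (ch : X → stdSimplex ℝ Y)
  (S : ∀ N, RandomCodingScheme X Rmax N (Θ N))

lemma eventually_exists_le_errorProb {P : ℝ → stdSimplex ℝ X}
    (hS : FollowsAsymptotically S P) {r : ℝ} (hr : 0 ≤ r) (hrR : r < Rmax)
    (hP : ContinuousWithinAt P (Set.Icc 0 Rmax) r) (hI : mutualInfo ch (P r) < r)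
    (D : DecoderSeq X Y Rmax) :
    ∀ᶠ N in atTop, ∃ W ∈ messageBlock Rmax N r, 1 / 2 ≤ errorProb ch S D N W := by
  have hR : 0 ≤ Rmax := hr.trans hrR.le
  set g := r - mutualInfo ch (P r) with hg
  have hg0 : 0 < g := sub_pos.2 hI
  -- The gap g is spent as follows: g/4 on the choice of q, g/8 each on continuity of `P` at r and
  -- on following `P`, g/4 on the threshold exponent r - g/4, and g/4 on Chebyshev's inequality.
  obtain ⟨q, hq0, hq1, hqle⟩ := exists_pos_dist_of_le ch (P r) (show 0 < g / 4 by positivity)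
  have hG := crossInfo_le ch hq0 hqle
  have hGcont := continuous_crossInfo ch q
  obtain ⟨η, hη, hηP⟩ := Metric.continuousWithinAt_iff.1
    (hGcont.continuousAt.comp_continuousWithinAt hP) (g / 8) (by positivity)
  have hpow : Tendsto (fun N : ℕ => (2 : ℝ) ^ (-((N : ℝ) * (g / 4)))) atTop (𝓝 0) := by
    have := tendsto_pow_atTop_nhds_zero_of_lt_one (r := (2 : ℝ) ^ (-(g / 4))) (by positivity)
      (Real.rpow_lt_one_of_one_lt_of_neg one_lt_two (by linarith))
    refine this.congr fun N => ?_
    rw [← Real.rpow_natCast, ← Real.rpow_mul two_pos.le]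
    ring_nf
  have hlim := (tendsto_const_div_natCast_mul
    (∑ z : X × Y, Real.logb 2 (ch z.1 z.2 / q z.2) ^ 2) ((g / 4) ^ 2)).add hpow
  rw [add_zero] at hlim
  have h2N : Tendsto (fun N : ℕ => 2 / (N : ℝ)) atTop (𝓝 0) :=
    tendsto_const_div_atTop_nhds_zero_nat 2
  filter_upwards [hS.eventually_dist_comp_lt hR hGcont (show 0 < g / 8 by positivity),
    hlim.eventually (gt_mem_nhds (show (0 : ℝ) < 1 / 2 by norm_num)),
    h2N.eventually (gt_mem_nhds hη), h2N.eventually (gt_mem_nhds (sub_pos.2 hrR)),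
    eventually_gt_atTop 0] with N hdist hsmall hN1 hN2 hN0
  have hN' : (0 : ℝ) < N := by exact_mod_cast hN0
  by_contra! hcon
  set τ := r - g / 4 with hτ
  have hcorrect : ∀ W ∈ messageBlock Rmax N r,
      1 / 2 ≤ sentProb ch (S N).inputDist W (fun c y => D N c y = some W) := by
    intro W hW
    have h1 := hcon W hW
    have h2 := sentProb_add_sentProb_not ch (S N).inputDist W (fun c y => D N c y = some W)
    rw [errorProb_eq_sentProb] at h1
    simp only [ne_eq] at h1
    linarith
  have hfail : ∀ W ∈ messageBlock Rmax N r, sentProb ch (S N).inputDist W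
      (fun c (y : Fin N → Y) => (2 : ℝ) ^ (N * τ) * ∏ j, q (y j) < blockProb ch (c W) y) ≤
      (∑ z : X × Y, Real.logb 2 (ch z.1 z.2 / q z.2) ^ 2) / (N * (g / 4) ^ 2) := by
    intro W hW
    refine sentProb_likelihood_gt_le ch (S N).inputDist hN0 W hq0 (by positivity) ?_
    have h1 := stdRate_mem_of_mem_messageBlock hN0 hr hW
    have h2 := hηP (stdRate_mem_Icc hR W) (by
      rw [Real.dist_eq, abs_lt]; constructor <;> linarith [h1.1, h1.2])
    have h3 := hdist W
    rw [Real.dist_eq, abs_lt] at h2 h3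
    simp only [Function.comp] at h2
    linarith [h2.2, h3.2]
  have hsum := sum_sentProb_decode_le ch (S N).inputDist (D N) (messageBlock Rmax N r)
    (show (0 : ℝ) ≤ 2 ^ (N * τ) by positivity) (fun y => (hq0 y).le) hq1
  have hl := (Finset.card_nsmul_le_sum _ _ _ hcorrect).trans
    (hsum.trans (add_le_add_left (Finset.sum_le_card_nsmul _ _ _ hfail) _))
  rw [nsmul_eq_mul, nsmul_eq_mul] at hl
  have hcard : (2 : ℝ) ^ ((N : ℝ) * r) ≤ (messageBlock Rmax N r).card := by
    refine le_card_messageBlock hr ?_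
    rw [div_lt_iff₀ hN'] at hN2
    linarith
  have hsplit : (2 : ℝ) ^ (N * τ) = 2 ^ (-((N : ℝ) * (g / 4))) * 2 ^ ((N : ℝ) * r) := by
    rw [← Real.rpow_add two_pos]
    congr 1
    rw [hτ]; ring
  have hcpos : (0 : ℝ) < (messageBlock Rmax N r).card :=
    (show (0 : ℝ) < 2 ^ ((N : ℝ) * r) by positivity).trans_le hcard
  have h5 : (2 : ℝ) ^ (N * τ) ≤
      2 ^ (-((N : ℝ) * (g / 4))) * (messageBlock Rmax N r).card := by
    rw [hsplit]
    gcongr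
  -- With B the block size, B/2 is at most B times the quantity made smaller than 1/2 by `hsmall`,
  -- and B > 0.
  nlinarith

lemma AsymptoticallyAchievable.le_mutualInfo {P : ℝ → stdSimplex ℝ X}
    (hS : FollowsAsymptotically S P) {R : Set ℝ} (hRsub : R ⊆ Set.Icc 0 Rmax)
    (hA : AsymptoticallyAchievable ch S R) {r δ : ℝ} (hδ : 0 < δ) (hrR : Set.Icc r (r + δ) ⊆ R)
    (hP : ContinuousWithinAt P (Set.Icc 0 Rmax) r) : r ≤ mutualInfo ch (P r) := by
  classical
  by_contra! hI
  obtain ⟨D, hD, -⟩ := hA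
  have hr : 0 ≤ r := (hRsub (hrR ⟨le_rfl, by linarith⟩)).1
  have hr2 : r < Rmax := by
    have := (hRsub (hrR ⟨by linarith, le_rfl⟩)).2
    linarith
  have hev := eventually_exists_le_errorProb ch S hS hr hr2 hP hI D
  -- One badly decoded message per block. Its rate lies in [r, r + 2/N], so it tends to r from
  -- within the interval contained in the region.
  let W : ∀ N, Message Rmax N := fun N =>
    if h : ∃ W ∈ messageBlock Rmax N r, 1 / 2 ≤ errorProb ch S D N W then h.choose
    else zeroMessage (hr.trans hr2.le) N
  have hW : ∀ᶠ N in atTop, W N ∈ messageBlock Rmax N r ∧ 1 / 2 ≤ errorProb ch S D N (W N) := by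
    filter_upwards [hev] with N hN
    simp only [W, dif_pos hN]
    exact hN.choose_spec
  have h2N : Tendsto (fun N : ℕ => 2 / (N : ℝ)) atTop (𝓝 0) :=
    tendsto_const_div_atTop_nhds_zero_nat 2
  have hmem : ∀ᶠ N : ℕ in atTop, stdRate (W N) ∈ Set.Icc r (r + 2 / N) := by
    filter_upwards [hW, eventually_gt_atTop 0] with N hN hN0
    exact stdRate_mem_of_mem_messageBlock hN0 hr hN.1
  have hlim : Tendsto (fun N => stdRate (W N)) atTop (𝓝 r) := by
    refine tendsto_of_tendsto_of_tendsto_of_le_of_le' tendsto_const_nhds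
      (by simpa using h2N.const_add r) (hmem.mono fun N h => h.1) (hmem.mono fun N h => h.2)
  have hin : ∀ᶠ N in atTop, stdRate (W N) ∈ R := by
    filter_upwards [hmem, h2N.eventually (gt_mem_nhds hδ)] with N h1 h2
    exact hrR ⟨h1.1, by linarith [h1.2]⟩
  have herr := hD W hin ⟨r, hrR ⟨le_rfl, by linarith⟩, hlim⟩
  obtain ⟨N, h1, h2⟩ :=
    ((herr.eventually (gt_mem_nhds (show (0 : ℝ) < 1 / 2 by norm_num))).and hW).exists
  linarith [h2.2]

end Converse

theorem theorem1 {X Y : Type*} [Fintype X] [Fintype Y] (Rmax : ℝ) (hRmax : 0 < Rmax)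
    (ch : X → stdSimplex ℝ Y) (P : ℝ → stdSimplex ℝ X)
    (hP : {r ∈ Set.Icc 0 Rmax | ¬ ContinuousWithinAt P (Set.Icc 0 Rmax) r}.Finite)
    {Θ : ℕ → Type*} [∀ N, MeasurableSpace (Θ N)]
    (S : ∀ N, RandomCodingScheme X Rmax N (Θ N)) (hS : FollowsAsymptotically S P) :
    (ZeroRateDetectable Rmax ch P →
      (∃ D : DecoderSeq X Y Rmax, ReliableWithBackoff ch S D P ∧
        CollisionOutside ch S D (standardRegion Rmax ch P)) ∧
      (LocallyPositiveMargin Rmax ch P →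
        AsymptoticallyAchievable ch S (standardRegion Rmax ch P))) ∧
    (∀ R : Set ℝ, R ⊆ Set.Icc 0 Rmax → AsymptoticallyAchievable ch S R →
      ∀ r δ : ℝ, 0 < δ → Set.Icc r (r + δ) ⊆ R →
        ContinuousWithinAt P (Set.Icc 0 Rmax) r → r ≤ mutualInfo ch (P r)) := by

  refine ⟨fun hZ => ?_, fun R hR hA r δ hδ hrR hc =>
    hA.le_mutualInfo ch S hS hR hδ hrR hc⟩
  obtain ⟨D, hD, hC⟩ : ∃ D : DecoderSeq X Y Rmax, ReliableWithBackoff ch S D P ∧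
      CollisionOutside ch S D (standardRegion Rmax ch P) :=
    hZ.elim (exists_decoderSeq_of_mutualInfo_pos ch S hS hRmax.le)
      (exists_decoderSeq_of_outputDist_separated ch S hS hRmax.le)
  exact ⟨⟨D, hD, hC⟩, AsymptoticallyAchievable.of_reliableWithBackoff ch S hD hC⟩
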